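/- **Setting.** Let $K\subset\mathbb R^2$ be a bounded convex open set (a grid cell) and $K_f\subset K$ a nonempty open subset (the fracture part). Put $K_m=K\setminus\overline{K_f}$ (the matrix part), $\Gamma_I=\partial K_f\cap K$ (the interface), $\Gamma_m=\partial K_m\cap\partial K$, $\Gamma_f=\partial K_f\cap\partial K$. Assume that $K_m\ne\emptyset$, that $\Gamma_I$ has zero area, and that $\overline{\Gamma_I}\cap\partial K$ is finite (possibly empty). Let $c_m,c_f,\Phi_m,\Phi_f,\mu,\bar q_f>0$ be constants, and let $\mathbf K$ be a measurable, symmetric, bounded and uniformly positive definite permeability tensor on $K$, equal to $\mathbf K_m$ in $K_m$ and to $\mathbf K_f$ in $K_f$. Write $|\cdot|$ for area and $u=-\frac{\mathbf K}{\mu}\nabla p$ for the Darcy flux. The slightly compressible matrix-fracture flow problem for a pressure $p$ (with $p_m=p|_{K_m}$, $p_f=p|_{K_f}$) is $$c_m\Phi_m\partial_t p_m-\nabla\cdot\Big(\frac{\mathbf K_m}{\mu}\nabla p_m\Big)=0\ \text{ in }K_m,\qquad c_f\Phi_f\partial_t p_f-\nabla\cdot\Big(\frac{\mathbf K_f}{\mu}\nabla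 p_f\Big)=\bar q_f\ \text{ in }K_f,$$ with no flow ($u\cdot n=0$) through $\Gamma_m$ and $\Gamma_f$, and with continuity of pressure and of normal flux across $\Gamma_I$. *Solution for $t>T$* means: for every $t>T$ the pressure $p(t)$ is in $H^1(K_m)$ and $H^1(K_f)$, it has a time derivative $\partial_tp(t)$ in $L^2(K_m)$ and $L^2(K_f)$ (limit of difference quotients in $L^2$), the two equations hold with weak derivatives, and the boundary and interface conditions hold for the weak traces. Here the normal trace of $u$ on $\partial D$ is the functional $\varphi\mapsto\int_D(u\cdot\nabla\varphi+\varphi\,\nabla\cdot u)$ and the trace of $p$ is $\varphi\mapsto\int_D(p\nabla\varphi+\varphi\nabla p)$, for $D=K_m,K_f$; conditions on $\Gamma_m,\Gamma_f$ are tested with smooth $\varphi$ vanishing near $\overline{\Gamma_I}$, those on $\Gamma_I$ with $\varphi\in C_c^\infty(K)$. For $q_s\in\mathbb R$, the *stationary Neumann problem with parameter $q_s$* is $$-\nabla\cdot\Big(\frac{\mathbf K}{\mu}\nabla w\Big)=\begin{cases}q_s&\text{in }K_f\\-\frac{|K_f|}{|K_m|}q_s&\text{in }K_m\end{cases},\qquad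 -\Big(\frac{\mathbf K}{\mu}\nabla w\Big)\cdot n=0\ \text{ on }\partial K,\qquad \frac1{|K|}\int_K w=0,$$ with $w\in H^1(K)$, weak derivatives, and the weak normal trace on $\partial K$ tested with all smooth $\varphi$. The *balance* for $a_m,a_f\in\mathbb R$ is $$|K_m|c_m\Phi_m a_m+|K_f|c_f\Phi_f a_f=|K_f|\,\bar q_f .\tag{B}$$ **Theorem.** 1. Every solution for $t>T$ satisfies, at every $t>T$, $\displaystyle\int_{K_m}c_m\Phi_m\partial_tp_m+\int_{K_f}c_f\Phi_f\partial_tp_f=\int_{K_f}\bar q_f$. 2. For each $q_s$, the stationary problem has at most one solution, up to equality almost everywhere. 3. (Exact pseudo steady state.) Let $T,a_m,a_f\in\mathbb R$. The function $p$ is a solution for $t>T$ with $\partial_tp_m=a_m$ and $\partial_tp_f=a_f$ for all $t>T$ if and only if: (B) holds; $a_m=a_f$; for every $t>T$ the function $p(t)-\frac1{|K|}\int_Kp(t)$ solves the stationary problem with parameter $\bar q_{f,s}=\bar q_f-c_f\Phi_fa_f$; and there is a constant $C$ with $\frac1{|K|}\int_Kp(t)=a_ft+C$ for all $t>T$. 4.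 (Zero initial data.) Let $p$ be a solution for $t>0$ with zero initial data, $p(0)=0$ and $p(t)\to0$ in $L^2(K)$ as $t\to0^+$, which approaches a pseudo steady state: $\partial_tp_m(t)\to a_m$ in $L^2(K_m)$ and $\partial_tp_f(t)\to a_f$ in $L^2(K_f)$ as $t\to\infty$, with $a_m,a_f\in\mathbb R$. Then (B) holds, $a_m=a_f$, and $p(t)\in H^1(K)$ for $t>0$; moreover, as $t\to\infty$, $p(t)-\frac1{|K|}\int_Kp(t)$ converges in $H^1(K)$ to a solution of the stationary problem with parameter $\bar q_{f,s}=\bar q_f-c_f\Phi_fa_f$. -/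

import Mathlib

open MeasureTheory Set Filter Topology
open scoped ENNReal ContDiff Gradient

noncomputable section

/-- The plane with its Euclidean norm. -/
abbrev Plane : Type := EuclideanSpace ℝ (Fin 2)

/-- Test functions of an open set `D`: smooth functions whose support is a compact subset
of `D`. -/
def IsTestFunction (D : Set Plane) (φ : Plane → ℝ) : Prop :=
  ContDiff ℝ ∞ φ ∧ HasCompactSupport φ ∧ tsupport φ ⊆ D

/-- `u` belongs to `H¹(D)` and `G` is its weak gradient on `D`. -/
structure HasH1Gradient (D : Set Plane) (u : Plane → ℝ) (G : Plane → Plane) : Prop where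
  memLp : MemLp u 2 (volume.restrict D)
  memLp_gradient : MemLp G 2 (volume.restrict D)
  weak_gradient : ∀ φ, IsTestFunction D φ →
    ∫ x in D, u x • ∇ φ x = -∫ x in D, φ x • G x

/-- The vector field `w ∈ L²(D)` has the weak divergence `g ∈ L²(D)` on `D`. -/
structure HasWeakDivergence (D : Set Plane) (w : Plane → Plane) (g : Plane → ℝ) : Prop where
  memLp : MemLp w 2 (volume.restrict D)
  memLp_div : MemLp g 2 (volume.restrict D)
  weak_div : ∀ φ, IsTestFunction D φ →
    ∫ x in D, inner ℝ (w x) (∇ φ x) = -∫ x in D, g x * φ x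

/-- The pairing of the outward normal trace on `∂D` of a field `w` with divergence `g` on `D`
against a smooth function `φ`. Where the fields are regular up to the boundary, Green's formula
gives that this is the boundary integral of `(w · n) φ` over `∂D`. -/
def normalTrace (D : Set Plane) (w : Plane → Plane) (g φ : Plane → ℝ) : ℝ :=
  ∫ x in D, (inner ℝ (w x) (∇ φ x) + g x * φ x)

/-- The pairing of the boundary trace on `∂D` of a function `u ∈ H¹(D)` with weak gradient `G`
against a smooth function `φ`. Where the functions are regular up to the boundary, Green's formula
gives that this is the boundary integral of `u φ n` over `∂D`, with `n` the outward normal. -/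
def pressureTrace (D : Set Plane) (u : Plane → ℝ) (G : Plane → Plane) (φ : Plane → ℝ) : Plane :=
  ∫ x in D, (u x • ∇ φ x + φ x • G x)

/-- `s` is the time derivative of `p` at time `t`, in `L²(D)`. -/
def HasL2TimeDeriv (D : Set Plane) (p : ℝ → Plane → ℝ) (s : Plane → ℝ) (t : ℝ) : Prop :=
  MemLp s 2 (volume.restrict D) ∧
  Tendsto (fun h : ℝ =>
      eLpNorm (fun x => h⁻¹ * (p (t + h) x - p t x) - s x) 2 (volume.restrict D))
    (𝓝[≠] 0) (𝓝 0)

/-- A grid cell cut by a fracture, with the physical data of the matrix-fracture local problem.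
The interface `Γ_I` is the part of the boundary of the fracture region inside the cell. It has
zero area, and it reaches the boundary of the cell at finitely many points at most (none if the
fracture is immersed in the cell, the corners of the fracture region where the fracture leaves
the cell). -/
structure MFProblem where
  /-- the cell -/
  K : Set Plane
  /-- the fracture part of the cell -/
  Kf : Set Plane
  isOpen_K : IsOpen K
  convex_K : Convex ℝ K
  isBounded_K : Bornology.IsBounded K
  isOpen_Kf : IsOpen Kf
  Kf_subset : Kf ⊆ K
  Kf_nonempty : Kf.Nonempty
  Km_nonempty : (K \ closure Kf).Nonempty
  interface_null : volume (frontier Kf ∩ K) = 0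
  interface_ends : (closure (frontier Kf ∩ K) ∩ frontier K).Finite
  /-- the permeability tensor, with possibly different values in matrix and fracture -/
  perm : Plane → Plane →L[ℝ] Plane
  perm_measurable : ∀ v, Measurable fun x => perm x v
  perm_symm : ∀ x ∈ K, ∀ v w, inner ℝ (perm x v) w = inner ℝ v (perm x w)
  perm_elliptic : ∃ α : ℝ, 0 < α ∧ ∀ x ∈ K, ∀ v, α * ‖v‖ ^ 2 ≤ inner ℝ (perm x v) v
  perm_bounded : ∃ β : ℝ, ∀ x ∈ K, ‖perm x‖ ≤ β
  /-- the dynamic viscosity -/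
  visc : ℝ
  visc_pos : 0 < visc
  /-- the compressibilities in matrix and fracture -/
  cm : ℝ
  cf : ℝ
  cm_pos : 0 < cm
  cf_pos : 0 < cf
  /-- the porosities of matrix and fracture -/
  Φm : ℝ
  Φf : ℝ
  Φm_pos : 0 < Φm
  Φf_pos : 0 < Φf
  /-- the source in the fracture -/
  q : ℝ
  q_pos : 0 < q

namespace MFProblem

variable (P : MFProblem)

/-- The matrix part of the cell. -/
def Km : Set Plane := P.K \ closure P.Kf

/-- The matrix-fracture interface. -/
def interface : Set Plane := frontier P.Kf ∩ P.K

/-- The Darcy flux `-(𝐊/μ) G` of a pressure with gradient `G`. -/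
def darcyFlux (G : Plane → Plane) : Plane → Plane :=
  fun x => -(P.visc⁻¹ • P.perm x (G x))

/-- The flow problem at one instant: `p` is the pressure and `s` its time derivative. The
equations hold separately in `K_m` and in `K_f`, there is no flow through `Γ_m` and `Γ_f`, and
pressure and normal flux are continuous across the interface `Γ_I`. Conditions on `Γ_m` and `Γ_f`
are tested by functions that vanish near the interface, those on `Γ_I` by functions that vanish
near the boundary of the cell. -/
def HoldsAt (p s : Plane → ℝ) : Prop :=
  ∃ (G : Plane → Plane) (g : Plane → ℝ),
    HasH1Gradient P.Km p G ∧ HasH1Gradient P.Kf p G ∧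
    -- `c_m Φ_m ∂p_m/∂t - ∇ · ((𝐊_m/μ) ∇p_m) = 0` in `K_m`
    HasWeakDivergence P.Km (P.darcyFlux G) g ∧
    (∀ᵐ x ∂volume.restrict P.Km, P.cm * P.Φm * s x + g x = 0) ∧
    -- `c_f Φ_f ∂p_f/∂t - ∇ · ((𝐊_f/μ) ∇p_f) = q` in `K_f`
    HasWeakDivergence P.Kf (P.darcyFlux G) g ∧
    (∀ᵐ x ∂volume.restrict P.Kf, P.cf * P.Φf * s x + g x = P.q) ∧
    -- no flow through `Γ_m` and `Γ_f`
    (∀ φ : Plane → ℝ, ContDiff ℝ ∞ φ → Disjoint (tsupport φ) (closure P.interface) →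
      normalTrace P.Km (P.darcyFlux G) g φ = 0 ∧ normalTrace P.Kf (P.darcyFlux G) g φ = 0) ∧
    -- `p_m = p_f` on `Γ_I`
    (∀ φ, IsTestFunction P.K φ → pressureTrace P.Km p G φ + pressureTrace P.Kf p G φ = 0) ∧
    -- equal normal fluxes on `Γ_I` (the outward normals of `K_m` and `K_f` are opposite there)
    (∀ φ, IsTestFunction P.K φ →
      normalTrace P.Km (P.darcyFlux G) g φ + normalTrace P.Kf (P.darcyFlux G) g φ = 0)

/-- `p`, with time derivative `s`, solves the flow problem, without initial condition, at all times
`t > T`. -/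
def IsSolutionAfter (T : ℝ) (p s : ℝ → Plane → ℝ) : Prop :=
  ∀ t, T < t →
    HasL2TimeDeriv P.Km p (s t) t ∧ HasL2TimeDeriv P.Kf p (s t) t ∧ P.HoldsAt (p t) (s t)

/-- `p`, with time derivative `s`, solves the initial-boundary value problem with zero initial
data. -/
def IsInitialValueSolution (p s : ℝ → Plane → ℝ) : Prop :=
  P.IsSolutionAfter 0 p s ∧
  (∀ᵐ x ∂volume.restrict P.K, p 0 x = 0) ∧
  Tendsto (fun t => eLpNorm (p t) 2 (volume.restrict P.K)) (𝓝[>] 0) (𝓝 0)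

/-- `p` solves the flow problem for `t > T` and is at pseudo steady state there:
`∂p_m/∂t = a_m` and `∂p_f/∂t = a_f`. -/
def IsPseudoSteadyAfter (T : ℝ) (p : ℝ → Plane → ℝ) (am af : ℝ) : Prop :=
  ∃ s : ℝ → Plane → ℝ, P.IsSolutionAfter T p s ∧
    ∀ t, T < t → (∀ᵐ x ∂volume.restrict P.Km, s t x = am) ∧
      (∀ᵐ x ∂volume.restrict P.Kf, s t x = af)

/-- The time derivatives `∂p_m/∂t` and `∂p_f/∂t` tend to the constants `a_m` and `a_f` in `L²` as
time tends to infinity. -/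
def TendsToPseudoSteady (s : ℝ → Plane → ℝ) (am af : ℝ) : Prop :=
  Tendsto (fun t => eLpNorm (fun x => s t x - am) 2 (volume.restrict P.Km)) atTop (𝓝 0) ∧
  Tendsto (fun t => eLpNorm (fun x => s t x - af) 2 (volume.restrict P.Kf)) atTop (𝓝 0)

/-- The balance `|K_m| c_m Φ_m a_m + |K_f| c_f Φ_f a_f = |K_f| q`. -/
def Balance (am af : ℝ) : Prop :=
  volume.real P.Km * P.cm * P.Φm * am + volume.real P.Kf * P.cf * P.Φf * af
    = volume.real P.Kf * P.q

/-- The source of the stationary problem: `qs` in `K_f` and `-(|K_f|/|K_m|) qs` in `K_m`. -/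
def stationarySource (qs : ℝ) : Plane → ℝ := fun x =>
  P.Kf.indicator (fun _ => qs) x
    + P.Km.indicator (fun _ => -(volume.real P.Kf / volume.real P.Km) * qs) x

/-- `w` solves the stationary pure Neumann problem with source parameter `qs`, on the whole cell,
and has zero mean. -/
def IsStationarySolution (qs : ℝ) (w : Plane → ℝ) : Prop :=
  (∃ G : Plane → Plane,
    HasH1Gradient P.K w G ∧
    HasWeakDivergence P.K (P.darcyFlux G) (P.stationarySource qs) ∧
    ∀ φ : Plane → ℝ, ContDiff ℝ ∞ φ →
      normalTrace P.K (P.darcyFlux G) (P.stationarySource qs) φ = 0) ∧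
  ⨍ x in P.K, w x = 0

/-- The deviation of a pressure from its mean over the cell. -/
def fluctuation (p : Plane → ℝ) : Plane → ℝ := fun x => p x - ⨍ y in P.K, p y

end MFProblem

end

/-! At each fixed time the coupled problem collapses to one pure Neumann problem on the whole cell.
Continuity of pressure, tested in `K`, is the weak gradient identity across the interface, so the
pressure is in `H¹(K)`. For the flux, a test function that avoids the finitely many ends of the
interface splits by a cutoff into a piece supported inside `K` and a piece vanishing near the
interface, and the given conditions cover both. The ends are harmless because points have zero `H¹`
capacity in the plane. Hence the flux has zero normal trace on `∂K` and its divergence is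
`fluxDivergence` of the time derivative (`HoldsAt.exists_gradient`). Testing with the constant `1`
is the mass balance.

The Neumann problem is stable: testing it with its own solution and using ellipticity and the
Poincaré inequality bounds the gradient and the deviation from the mean, in `L²`, by the source
(`exists_stability`, `exists_stability_sub`). Both the Poincaré inequality and the choice of the
solution as test function rest on approximation by functions smooth on the whole plane, which
convexity of `K` provides (`HasH1Gradient.exists_smooth_approx`).

Uniqueness is immediate from stability. If the time derivatives converge, so do the sources, and
stability makes the gradients and fluctuations Cauchy in `L²`; their limit solves the stationary
problem (`IsSolutionAfter.exists_limit`). The balance passes to the limit and identifies the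
limiting matrix source. The two rates agree because the difference of the mean pressures in matrix
and fracture depends only on the fluctuation, hence converges, while its derivative tends to `am -
af` (`IsSolutionAfter.rates_eq`).

Constant rates are a special case of convergent ones. Conversely, uniqueness freezes the fluctuation
in time, so a linearly growing mean yields an exact solution; the separate conditions on `Γ_m` and
`Γ_f` follow because the two parts are separated away from the interface. -/

section L2Tools

variable {α E F H ι : Type*} [MeasurableSpace α] {μ : Measure α}
  [NormedAddCommGroup E] [NormedSpace ℝ E] [NormedAddCommGroup F] [NormedSpace ℝ F]
  [NormedAddCommGroup H] [NormedSpace ℝ H]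

/-! ### Bilinear pairings in `L²` -/

theorem eLpNorm_one_bilin_le (B : E →L[ℝ] F →L[ℝ] H) {f : α → E} {h : α → F}
    (hf : AEStronglyMeasurable f μ) (hh : AEStronglyMeasurable h μ) :
    eLpNorm (fun x => B (f x) (h x)) 1 μ ≤ ‖B‖ₑ * eLpNorm f 2 μ * eLpNorm h 2 μ :=
  eLpNorm_le_eLpNorm_mul_eLpNorm_of_nnnorm hf hh (fun a b => B a b) ‖B‖₊
    (.of_forall fun x => B.le_opNorm₂ (f x) (h x))

theorem integrable_bilin (B : E →L[ℝ] F →L[ℝ] H) {f : α → E} {h : α → F}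
    (hf : MemLp f 2 μ) (hh : MemLp h 2 μ) : Integrable (fun x => B (f x) (h x)) μ :=
  memLp_one_iff_integrable.1
    (MemLp.of_bilin (fun a b => B a b) ‖B‖₊ hf hh (B.aestronglyMeasurable_comp₂ hf.1 hh.1)
      (.of_forall fun x => B.le_opNorm₂ (f x) (h x)))

theorem enorm_integral_bilin_le (B : E →L[ℝ] F →L[ℝ] H) {f : α → E} {h : α → F}
    (hf : AEStronglyMeasurable f μ) (hh : AEStronglyMeasurable h μ) :
    ‖∫ x, B (f x) (h x) ∂μ‖ₑ ≤ ‖B‖ₑ * eLpNorm f 2 μ * eLpNorm h 2 μ := by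
  refine (enorm_integral_le_lintegral_enorm _).trans ?_
  rw [← eLpNorm_one_eq_lintegral_enorm]
  exact eLpNorm_one_bilin_le B hf hh

/-- Every term of the weak formulations is a pairing by a continuous bilinear map (inner product,
product, scalar multiplication), so this one fact carries all weak identities to `L²` limits. -/
theorem tendsto_integral_bilin (B : E →L[ℝ] F →L[ℝ] H) {l : Filter ι} {f : ι → α → E}
    {f₀ : α → E} {h : α → F} (hf : ∀ᶠ i in l, MemLp (f i) 2 μ) (hf₀ : MemLp f₀ 2 μ)
    (hh : MemLp h 2 μ) (hlim : Tendsto (fun i => eLpNorm (fun x => f i x - f₀ x) 2 μ) l (𝓝 0)) :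
    Tendsto (fun i => ∫ x, B (f i x) (h x) ∂μ) l (𝓝 (∫ x, B (f₀ x) (h x) ∂μ)) := by
  refine tendsto_integral_of_L1' _ (integrable_bilin B hf₀ hh).1
    (hf.mono fun i hi => integrable_bilin B hi hh) ?_
  have hbound : Tendsto (fun i => ‖B‖ₑ * eLpNorm (fun x => f i x - f₀ x) 2 μ * eLpNorm h 2 μ)
      l (𝓝 0) := by
    have := ENNReal.Tendsto.mul_const (ENNReal.Tendsto.const_mul (a := ‖B‖ₑ) hlim (by simp))
      (b := eLpNorm h 2 μ) (Or.inr hh.2.ne)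
    simpa using this
  refine tendsto_of_tendsto_of_tendsto_of_le_of_le' tendsto_const_nhds hbound
    (.of_forall fun _ => zero_le) (hf.mono fun i hi => ?_)
  have : (fun x => B (f i x) (h x)) - (fun x => B (f₀ x) (h x))
      = fun x => B (f i x - f₀ x) (h x) := by
    ext x; simp
  rw [this]
  exact eLpNorm_one_bilin_le B (hi.1.sub hf₀.1) hh.1

/-- Over a finite measure, convergence in `L²` implies convergence of the integrals. -/
theorem tendsto_integral_of_L2 [IsFiniteMeasure μ] {l : Filter ι} {f : ι → α → E}
    {f₀ : α → E} (hf : ∀ᶠ i in l, MemLp (f i) 2 μ) (hf₀ : MemLp f₀ 2 μ)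
    (hlim : Tendsto (fun i => eLpNorm (fun x => f i x - f₀ x) 2 μ) l (𝓝 0)) :
    Tendsto (fun i => ∫ x, f i x ∂μ) l (𝓝 (∫ x, f₀ x ∂μ)) := by
  have := tendsto_integral_bilin (ContinuousLinearMap.lsmul ℝ ℝ : ℝ →L[ℝ] E →L[ℝ] E).flip
    hf hf₀ (memLp_const (1 : ℝ)) hlim
  simpa using this

end L2Tools

theorem MeasureTheory.MemLp.integrable_two {α E : Type*} [MeasurableSpace α] {μ : Measure α}
    [NormedAddCommGroup E] [IsFiniteMeasure μ] {f : α → E} (hf : MemLp f 2 μ) : Integrable f μ :=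
  hf.integrable one_le_two

/-! ### Smooth test functions and the normal trace -/

theorem gradient_mul {φ ψ : Plane → ℝ} {x : Plane} (hφ : DifferentiableAt ℝ φ x)
    (hψ : DifferentiableAt ℝ ψ x) :
    ∇ (fun y => φ y * ψ y) x = φ x • ∇ ψ x + ψ x • ∇ φ x := by
  simp [gradient, fderiv_fun_mul hφ hψ]

theorem gradient_fun_add {φ ψ : Plane → ℝ} {x : Plane} (hφ : DifferentiableAt ℝ φ x)
    (hψ : DifferentiableAt ℝ ψ x) : ∇ (fun y => φ y + ψ y) x = ∇ φ x + ∇ ψ x := by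
  simp [gradient, fderiv_fun_add hφ hψ]

theorem norm_gradient (φ : Plane → ℝ) (x : Plane) : ‖∇ φ x‖ = ‖fderiv ℝ φ x‖ := by
  simp [gradient]

theorem ContDiff.continuous_gradient {φ : Plane → ℝ} (hφ : ContDiff ℝ ∞ φ) : Continuous (∇ φ) := by
  unfold gradient
  exact (LinearIsometryEquiv.continuous _).comp (hφ.continuous_fderiv (by simp))

theorem gradient_eq_zero_of_notMem_tsupport {φ : Plane → ℝ} {x : Plane} (hx : x ∉ tsupport φ) :
    ∇ φ x = 0 := by
  have : fderiv ℝ φ x = 0 := by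
    by_contra h
    exact hx (tsupport_fderiv_subset ℝ (subset_tsupport _ h))
  simp [gradient, this]

/-- The bound is taken on the compact closure, which is measurable even when `D` is not. -/
theorem Continuous.memLp_restrict {E : Type*} [NormedAddCommGroup E] {f : Plane → E}
    (hf : Continuous f) {D : Set Plane} (hD : Bornology.IsBounded D) (p : ℝ≥0∞) :
    MemLp f p (volume.restrict D) := by
  have hc : IsCompact (closure D) := hD.isCompact_closure
  obtain ⟨C, hC⟩ := hc.exists_bound_of_continuousOn hf.continuousOn
  have : IsFiniteMeasure (volume.restrict (closure D)) := ⟨by simpa using hc.measure_lt_top⟩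
  have h : MemLp f p (volume.restrict (closure D)) :=
    MemLp.of_bound hf.aestronglyMeasurable C
      ((ae_restrict_iff' isClosed_closure.measurableSet).2 (.of_forall hC))
  exact h.mono_measure (Measure.restrict_mono subset_closure le_rfl)

theorem integrable_normalTrace {D : Set Plane} (hD : Bornology.IsBounded D) {w : Plane → Plane}
    {g φ : Plane → ℝ} (hw : MemLp w 2 (volume.restrict D)) (hg : MemLp g 2 (volume.restrict D))
    (hφ : ContDiff ℝ ∞ φ) :
    IntegrableOn (fun x => inner ℝ (w x) (∇ φ x) + g x * φ x) D :=
  (integrable_bilin (innerSL ℝ) hw (hφ.continuous_gradient.memLp_restrict hD 2)).add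
    (integrable_bilin (ContinuousLinearMap.mul ℝ ℝ) hg (hφ.continuous.memLp_restrict hD 2))

theorem normalTrace_add {D : Set Plane} (hD : Bornology.IsBounded D) {w : Plane → Plane}
    {g φ ψ : Plane → ℝ} (hw : MemLp w 2 (volume.restrict D))
    (hg : MemLp g 2 (volume.restrict D)) (hφ : ContDiff ℝ ∞ φ) (hψ : ContDiff ℝ ∞ ψ) :
    normalTrace D w g (fun x => φ x + ψ x) = normalTrace D w g φ + normalTrace D w g ψ := by
  unfold normalTrace
  rw [← integral_add (integrable_normalTrace hD hw hg hφ) (integrable_normalTrace hD hw hg hψ)]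
  congr 1 with x
  rw [gradient_fun_add (hφ.differentiable (by simp) x) (hψ.differentiable (by simp) x), inner_add_right]
  ring

/-! ### Zero capacity of points -/

/-- Smooth cutoffs at a point of the plane, at scale `1 / (n + 1)`: their gradients are bounded in
`L²`. -/
theorem exists_cutoff_sequence (z : Plane) :
    ∃ (η : ℕ → Plane → ℝ) (C : ℝ), (∀ n, ContDiff ℝ ∞ (η n)) ∧ (∀ n x, ‖η n x‖ ≤ 1) ∧
      (∀ n, ∀ᶠ x in 𝓝 z, η n x = 1) ∧
      (∀ (n : ℕ) x, x ∉ Metric.closedBall z (2 / ((n : ℝ) + 1)) → η n x = 0 ∧ ∇ (η n) x = 0) ∧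
      ∀ (n : ℕ) x, ‖∇ (η n) x‖ ≤ C * ((n : ℝ) + 1) := by
  let b : ContDiffBump (0 : Plane) := ⟨1, 2, by norm_num, by norm_num⟩
  have hb : ContDiff ℝ ∞ b := b.contDiff
  obtain ⟨C, hC⟩ := (hb.continuous_fderiv (by simp)).bounded_above_of_compact_support
    (b.hasCompactSupport.fderiv ℝ)
  have hpos : ∀ n : ℕ, (0 : ℝ) < n + 1 := fun n => by positivity
  have hsm : ∀ n : ℕ, ContDiff ℝ ∞ (fun x : Plane => b (((n : ℝ) + 1) • (x - z))) := fun n =>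
    hb.comp (by fun_prop)
  have hout : ∀ (n : ℕ) x, x ∉ Metric.closedBall z (2 / ((n : ℝ) + 1)) →
      b (((n : ℝ) + 1) • (x - z)) = 0 := by
    intro n x hx
    refine b.zero_of_le_dist ?_
    simp only [Metric.mem_closedBall, not_le, dist_eq_norm] at hx
    rw [dist_zero_right, norm_smul, Real.norm_of_nonneg (hpos n).le]
    rw [div_lt_iff₀ (hpos n)] at hx
    change (2 : ℝ) ≤ _
    linarith
  refine ⟨fun n x => b (((n : ℝ) + 1) • (x - z)), C, hsm, fun n x => ?_, fun n => ?_,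
    fun n x hx => ⟨hout n x hx, ?_⟩, fun n x => ?_⟩
  · rw [Real.norm_of_nonneg b.nonneg]
    exact b.le_one
  · have h1 : Tendsto (fun x : Plane => ((n : ℝ) + 1) • (x - z)) (𝓝 z) (𝓝 0) := by
      have : Continuous fun x : Plane => ((n : ℝ) + 1) • (x - z) := by fun_prop
      simpa using this.tendsto z
    exact h1.eventually b.eventuallyEq_one
  · refine gradient_eq_zero_of_notMem_tsupport fun h => hx ?_
    exact closure_minimal (fun y (hy : _ ≠ _) => by_contra fun h' => hy (hout n y h'))
      Metric.isClosed_closedBall h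
  · rw [norm_gradient]
    have h2 : HasFDerivAt (fun x : Plane => ((n : ℝ) + 1) • (x - z))
        (((n : ℝ) + 1) • ContinuousLinearMap.id ℝ Plane) x :=
      ((hasFDerivAt_id x).sub_const z).fun_const_smul _
    have h3 := ((hb.differentiable (by simp)).differentiableAt (x := ((n : ℝ) + 1) • (x - z))
      ).hasFDerivAt.comp x h2
    have h4 : fderiv ℝ (fun x : Plane => b (((n : ℝ) + 1) • (x - z))) x = _ := h3.fderiv
    rw [h4]
    refine (ContinuousLinearMap.opNorm_comp_le _ _).trans ?_
    refine mul_le_mul (hC _) ?_ (norm_nonneg _) ((norm_nonneg _).trans (hC 0))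
    rw [norm_smul, Real.norm_of_nonneg (hpos n).le]
    exact mul_le_of_le_one_right (hpos n).le ContinuousLinearMap.norm_id_le

/-- Absolute continuity of the integral of `‖w‖²`, applied to balls whose area tends to zero. -/
theorem tendsto_eLpNorm_indicator_closedBall {E : Type*} [NormedAddCommGroup E] {D : Set Plane}
    {w : Plane → E} (hw : MemLp w 2 (volume.restrict D)) (z : Plane) :
    Tendsto (fun n : ℕ => eLpNorm ((Metric.closedBall z (2 / ((n : ℝ) + 1))).indicator w) 2
      (volume.restrict D)) atTop (𝓝 0) := by
  rw [ENNReal.tendsto_nhds_zero]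
  intro ε hε
  obtain ⟨r, hr, hrε⟩ : ∃ r : ℝ, 0 < r ∧ ENNReal.ofReal r ≤ ε := by
    rcases eq_or_ne ε ∞ with rfl | h
    · exact ⟨1, one_pos, le_top⟩
    · exact ⟨ε.toReal, ENNReal.toReal_pos hε.ne' h, ENNReal.ofReal_toReal_le⟩
  obtain ⟨δ, hδ, h⟩ := hw.eLpNorm_indicator_le one_le_two (by simp) hr
  have hlim : Tendsto (fun n : ℕ => volume (Metric.closedBall z (2 / ((n : ℝ) + 1)))) atTop (𝓝 0) := by
    have h0 : Tendsto (fun n : ℕ => 2 / ((n : ℝ) + 1)) atTop (𝓝 0) := by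
      have := (tendsto_one_div_add_atTop_nhds_zero_nat (𝕜 := ℝ)).const_mul 2
      simpa [div_eq_mul_inv] using this
    simp_rw [EuclideanSpace.volume_closedBall_fin_two]
    have := (ENNReal.tendsto_ofReal h0)
    have h2 := ENNReal.Tendsto.mul_const (b := ENNReal.ofReal Real.pi) (ENNReal.Tendsto.pow (n := 2) this) (Or.inr (by simp))
    simpa using h2
  have hδ' : (0 : ℝ≥0∞) < ENNReal.ofReal δ := by simpa using hδ
  filter_upwards [(ENNReal.tendsto_nhds_zero.1 hlim) _ hδ'] with n hn
  exact (h _ Metric.isClosed_closedBall.measurableSet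
    ((Measure.restrict_apply_le _ _).trans hn)).trans hrε

/-- Points have zero capacity in the plane. -/
theorem normalTrace_eq_zero_of_forall_eventually {D : Set Plane} (hD : Bornology.IsBounded D)
    {w : Plane → Plane} {g φ : Plane → ℝ} (hw : MemLp w 2 (volume.restrict D))
    (hg : MemLp g 2 (volume.restrict D)) (hφ : ContDiff ℝ ∞ φ) (z : Plane)
    (h : ∀ ψ : Plane → ℝ, ContDiff ℝ ∞ ψ → (∀ᶠ x in 𝓝 z, ψ x = 0) → tsupport ψ ⊆ tsupport φ →
      normalTrace D w g ψ = 0) : normalTrace D w g φ = 0 := by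
  obtain ⟨η, C, hη, hη1, hηz, hηout, hηC⟩ := exists_cutoff_sequence z
  -- Write `φ = (1 - η n) φ + η n φ`. The first summand vanishes near `z` and contributes nothing;
  -- the product rule splits the second into a term with `η n` and a term with `∇ (η n)`, the latter
  -- living on the small ball.
  have hsplit : ∀ n, normalTrace D w g φ
      = (∫ x in D, η n x * (inner ℝ (w x) (∇ φ x) + g x * φ x))
        + ∫ x in D, innerSL ℝ ((Metric.closedBall z (2 / ((n : ℝ) + 1))).indicator w x)
            (φ x • ∇ (η n) x) := by
    intro n
    have h0 : normalTrace D w g (fun x => (1 - η n x) * φ x) = 0 := by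
      refine h _ ((contDiff_const.sub (hη n)).mul hφ) ?_ (tsupport_mul_subset_right)
      filter_upwards [hηz n] with x hx
      simp [hx]
    have hsm : ContDiff ℝ ∞ (fun x => η n x * φ x) := (hη n).mul hφ
    have h1 := normalTrace_add (φ := fun x => (1 - η n x) * φ x) hD hw hg
      ((contDiff_const.sub (hη n)).mul hφ) hsm
    have h2 : (fun x => (1 - η n x) * φ x + η n x * φ x) = φ := by ext x; ring
    rw [h2, h0, zero_add] at h1
    rw [h1, normalTrace, ← integral_add]
    · congr 1 with x
      rw [gradient_mul ((hη n).differentiable (by simp) x) (hφ.differentiable (by simp) x)]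
      by_cases hx : x ∈ Metric.closedBall z (2 / ((n : ℝ) + 1))
      · rw [indicator_of_mem hx, innerSL_apply_apply, inner_add_right, inner_smul_right,
          inner_smul_right]
        ring
      · simp [hηout n x hx]
    · refine (integrable_normalTrace hD hw hg hφ).bdd_mul (c := 1)
        (hη n).continuous.aestronglyMeasurable (.of_forall (hη1 n))
    · refine integrable_bilin _ (hw.indicator Metric.isClosed_closedBall.measurableSet) ?_
      exact (hφ.continuous.smul (hη n).continuous_gradient).memLp_restrict hD 2
  have hlim1 : Tendsto (fun n => ∫ x in D, η n x * (inner ℝ (w x) (∇ φ x) + g x * φ x)) atTop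
      (𝓝 0) := by
    have hint := integrable_normalTrace hD hw hg hφ
    have := tendsto_integral_of_dominated_convergence (μ := volume.restrict D)
      (F := fun n x => η n x * (inner ℝ (w x) (∇ φ x) + g x * φ x)) (f := fun _ => 0)
      (fun x => ‖inner ℝ (w x) (∇ φ x) + g x * φ x‖)
      (fun n => (hη n).continuous.aestronglyMeasurable.mul hint.1) hint.norm
      (fun n => .of_forall fun x => by
        rw [norm_mul]; exact mul_le_of_le_one_left (norm_nonneg _) (hη1 n x)) ?_
    · simpa using this
    · have hne : ∀ᵐ x ∂volume.restrict D, x ≠ z :=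
        ae_restrict_of_ae (Measure.ae_ne volume z)
      filter_upwards [hne] with x hx
      refine tendsto_const_nhds.congr' ?_
      have h0 : Tendsto (fun n : ℕ => 2 / ((n : ℝ) + 1)) atTop (𝓝 0) := by
        have := (tendsto_one_div_add_atTop_nhds_zero_nat (𝕜 := ℝ)).const_mul 2
        simpa [div_eq_mul_inv] using this
      filter_upwards [h0.eventually (gt_mem_nhds (dist_pos.2 hx))] with n hn
      rw [(hηout n x (by simpa using hn)).1, zero_mul]
  obtain ⟨M, hM⟩ : ∃ M, ∀ x ∈ Metric.closedBall z 2, ‖φ x‖ ≤ M :=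
    (isCompact_closedBall z 2).exists_bound_of_continuousOn hφ.continuous.continuousOn
  -- Here dimension two enters: a gradient of size `n + 1` on a disc of area of order `(n + 1)⁻²`
  -- has bounded `L²` norm.
  have hbd : ∀ n : ℕ, eLpNorm (fun x => φ x • ∇ (η n) x) 2 (volume.restrict D)
      ≤ ENNReal.ofReal (2 * |M * C| * √Real.pi) := by
    intro n
    set S := Metric.closedBall z (2 / ((n : ℝ) + 1)) with hS
    have hSm : MeasurableSet S := Metric.isClosed_closedBall.measurableSet
    have heq : (fun x => φ x • ∇ (η n) x) = S.indicator (fun x => φ x • ∇ (η n) x) := by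
      ext1 x
      by_cases hx : x ∈ S
      · rw [indicator_of_mem hx]
      · rw [indicator_of_notMem hx, (hηout n x hx).2, smul_zero]
    rw [heq, eLpNorm_indicator_eq_eLpNorm_restrict hSm, Measure.restrict_restrict hSm]
    have hae : ∀ᵐ x ∂volume.restrict (S ∩ D), ‖φ x • ∇ (η n) x‖ ≤ |M * C| * (n + 1) := by
      filter_upwards [ae_mono (Measure.restrict_mono inter_subset_left le_rfl)
        (ae_restrict_mem hSm)] with x hx
      have hx2 : x ∈ Metric.closedBall z 2 := by
        refine Metric.closedBall_subset_closedBall (div_le_self zero_le_two ?_) hx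
        linarith [n.cast_nonneg (α := ℝ)]
      rw [norm_smul]
      calc ‖φ x‖ * ‖∇ (η n) x‖ ≤ M * (C * (n + 1)) :=
            mul_le_mul (hM x hx2) (hηC n x) (norm_nonneg _) ((norm_nonneg _).trans (hM x hx2))
        _ = M * C * (n + 1) := by ring
        _ ≤ _ := by gcongr; exact le_abs_self _
    refine (eLpNorm_le_of_ae_bound hae).trans ?_
    have hvol : volume.restrict (S ∩ D) univ
        ≤ ENNReal.ofReal ((2 / ((n : ℝ) + 1)) ^ 2 * Real.pi) := by
      rw [Measure.restrict_apply_univ]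
      refine (measure_mono inter_subset_left).trans_eq ?_
      rw [hS, EuclideanSpace.volume_closedBall_fin_two, ENNReal.ofReal_mul (by positivity),
        ENNReal.ofReal_pow (by positivity)]
    calc _ ≤ ENNReal.ofReal ((2 / ((n : ℝ) + 1)) ^ 2 * Real.pi) ^ (2 : ℝ≥0∞).toReal⁻¹
          * ENNReal.ofReal (|M * C| * (n + 1)) := by gcongr
      _ = ENNReal.ofReal ((2 / ((n : ℝ) + 1)) * √Real.pi) * ENNReal.ofReal (|M * C| * (n + 1)) := by
        rw [ENNReal.ofReal_rpow_of_nonneg (by positivity) (by simp)]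
        congr 2
        rw [ENNReal.toReal_ofNat, ← one_div, ← Real.sqrt_eq_rpow,
          Real.sqrt_mul (by positivity), Real.sqrt_sq (by positivity)]
      _ = _ := by
        rw [← ENNReal.ofReal_mul (by positivity)]
        congr 1
        field_simp
  -- By Cauchy–Schwarz: the cutoff gradients are only bounded, but `w` restricted to the shrinking
  -- balls tends to zero.
  have hlim2 : Tendsto (fun n : ℕ => ∫ x in D,
      innerSL ℝ ((Metric.closedBall z (2 / ((n : ℝ) + 1))).indicator w x)
            (φ x • ∇ (η n) x)) atTop (𝓝 0) := by
    rw [tendsto_zero_iff_enorm_tendsto_zero]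
    have hb : Tendsto (fun n : ℕ => ‖(innerSL ℝ : Plane →L[ℝ] Plane →L[ℝ] ℝ)‖ₑ
        * eLpNorm ((Metric.closedBall z (2 / ((n : ℝ) + 1))).indicator w) 2 (volume.restrict D)
        * ENNReal.ofReal (2 * |M * C| * √Real.pi)) atTop (𝓝 0) := by
      have := ENNReal.Tendsto.mul_const (b := ENNReal.ofReal (2 * |M * C| * √Real.pi))
        (ENNReal.Tendsto.const_mul (a := ‖(innerSL ℝ : Plane →L[ℝ] Plane →L[ℝ] ℝ)‖ₑ)
          (tendsto_eLpNorm_indicator_closedBall hw z) (by simp)) (Or.inr (by simp))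
      simpa using this
    refine tendsto_of_tendsto_of_tendsto_of_le_of_le tendsto_const_nhds hb (fun _ => zero_le)
      fun n => ?_
    refine (enorm_integral_bilin_le (innerSL ℝ : Plane →L[ℝ] Plane →L[ℝ] ℝ)
      (hw.indicator Metric.isClosed_closedBall.measurableSet).1
      (hφ.continuous.smul (hη n).continuous_gradient).aestronglyMeasurable).trans ?_
    gcongr
    exact hbd n
  have hlim := hlim1.add hlim2
  simp only [← hsplit, add_zero] at hlim
  exact tendsto_nhds_unique tendsto_const_nhds hlim

theorem normalTrace_eq_zero_of_finite {D : Set Plane} (hD : Bornology.IsBounded D)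
    {w : Plane → Plane} {g : Plane → ℝ} (hw : MemLp w 2 (volume.restrict D))
    (hg : MemLp g 2 (volume.restrict D)) {F : Set Plane} (hF : F.Finite)
    (h : ∀ φ : Plane → ℝ, ContDiff ℝ ∞ φ → Disjoint (tsupport φ) F → normalTrace D w g φ = 0)
    {φ : Plane → ℝ} (hφ : ContDiff ℝ ∞ φ) : normalTrace D w g φ = 0 := by
  induction F, hF using Set.Finite.induction_on generalizing φ with
  | empty => exact h φ hφ (disjoint_empty _)
  | @insert z F _ _ ih =>
    refine ih (fun φ hφ hd => ?_) hφ
    -- The support of `ψ` lies in that of `φ`, so removing the point `z` does not lose disjointness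
    -- from the remaining points.
    refine normalTrace_eq_zero_of_forall_eventually hD hw hg hφ z fun ψ hψ hz hsub => ?_
    refine h ψ hψ ?_
    rw [disjoint_insert_right]
    exact ⟨notMem_tsupport_iff_eventuallyEq.2 hz, hd.mono_left hsub⟩

/-! ### Averages, dilations and translations in `L²` -/

theorem eLpNorm_two_pow {α E : Type*} [MeasurableSpace α] [NormedAddCommGroup E] (μ : Measure α)
    (f : α → E) : eLpNorm f 2 μ ^ 2 = ∫⁻ x, ‖f x‖ₑ ^ 2 ∂μ := by
  have := eLpNorm_nnreal_pow_eq_lintegral (f := f) (μ := μ) (p := 2) (by norm_num)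
  simpa using this

/-- The `L²` norm of an average is at most a bound for the `L²` norms of the averaged functions. -/
theorem eLpNorm_integral_le_of_ae_le {α β E : Type*} [MeasurableSpace α] [MeasurableSpace β]
    [NormedAddCommGroup E] [NormedSpace ℝ E] {μ : Measure α} [SFinite μ] {ν : Measure β}
    [IsProbabilityMeasure ν] {F : α → β → E} (hF : StronglyMeasurable (Function.uncurry F))
    {B : ℝ≥0∞} (hB : ∀ᵐ y ∂ν, eLpNorm (fun x => F x y) 2 μ ≤ B) :
    eLpNorm (fun x => ∫ y, F x y ∂ν) 2 μ ≤ B := by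
  rw [← ENNReal.pow_le_pow_left_iff two_ne_zero, eLpNorm_two_pow]
  calc ∫⁻ x, ‖∫ y, F x y ∂ν‖ₑ ^ 2 ∂μ ≤ ∫⁻ x, ∫⁻ y, ‖F x y‖ₑ ^ 2 ∂ν ∂μ := by
        refine lintegral_mono fun x => ?_
        rw [← eLpNorm_two_pow]
        gcongr
        refine (enorm_integral_le_lintegral_enorm _).trans ?_
        rw [← eLpNorm_one_eq_lintegral_enorm]
        exact eLpNorm_le_eLpNorm_of_exponent_le one_le_two
          (hF.comp_measurable measurable_prodMk_left).aestronglyMeasurable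
    _ = ∫⁻ y, ∫⁻ x, ‖F x y‖ₑ ^ 2 ∂μ ∂ν :=
        lintegral_lintegral_swap (hF.enorm.pow_const 2).aemeasurable
    _ ≤ ∫⁻ _, B ^ 2 ∂ν := by
        refine lintegral_mono_ae (hB.mono fun y hy => ?_)
        rw [← eLpNorm_two_pow]
        gcongr
    _ = B ^ 2 := by simp

theorem map_affine_volume {s : ℝ} (hs : s ≠ 0) (c : Plane) :
    Measure.map (fun x : Plane => s • x + c) volume = ENNReal.ofReal |(s ^ 2)⁻¹| • volume := by
  have h : (fun x : Plane => s • x + c) = (fun x => x + c) ∘ fun x => s • x := rfl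
  rw [h, ← Measure.map_map (by fun_prop) (by fun_prop), Measure.map_addHaar_smul _ hs,
    Measure.map_smul, map_add_right_eq_self]
  simp

theorem measurableEmbedding_affine {s : ℝ} (hs : s ≠ 0) (c : Plane) :
    MeasurableEmbedding (fun x : Plane => s • x + c) :=
  ((Homeomorph.smulOfNeZero s hs).trans (Homeomorph.addRight c)).measurableEmbedding

/-- The change of variables has Jacobian factor `s⁻² ≤ 4`, whose square root is the constant `2`. -/
theorem eLpNorm_comp_affine_le {E : Type*} [NormedAddCommGroup E] (f : Plane → E) {s : ℝ}
    (hs : 1 / 2 ≤ s) (c : Plane) :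
    eLpNorm (fun x => f (s • x + c)) 2 volume ≤ 2 * eLpNorm f 2 volume := by
  have hs0 : 0 < s := by linarith
  have h := (measurableEmbedding_affine hs0.ne' c).eLpNorm_map_measure (g := f) (p := 2)
    (μ := volume)
  rw [map_affine_volume hs0.ne', eLpNorm_smul_measure_of_ne_top (by simp)] at h
  change eLpNorm (f ∘ fun x => s • x + c) 2 volume ≤ _
  rw [← h, smul_eq_mul]
  gcongr
  calc _ ≤ (ENNReal.ofReal 4) ^ (1 / (2 : ℝ≥0∞)).toReal := by
        gcongr
        rw [abs_of_pos (by positivity), inv_le_comm₀ (by positivity) (by norm_num)]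
        nlinarith
    _ = 2 := by
        rw [show (4 : ℝ) = 2 ^ (2 : ℝ) by norm_num, ← ENNReal.ofReal_rpow_of_pos two_pos,
          ← ENNReal.rpow_mul]
        simp

/-- Approximate `f` in `L²` by a compactly supported continuous function, which is uniformly
continuous. The resulting `δ` is uniform in `c`, which allows `c` to be averaged later. -/
theorem eLpNorm_comp_affine_sub_le {E : Type*} [NormedAddCommGroup E] [NormedSpace ℝ E]
    {f : Plane → E} (hf : MemLp f 2 volume) {K : Set Plane} (hK : Bornology.IsBounded K)
    {ε : ℝ} (hε : 0 < ε) :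
    ∃ δ > 0, ∀ s : ℝ, 1 / 2 ≤ s → |s - 1| < δ → ∀ c : Plane, ‖c‖ < δ →
      eLpNorm (fun x => f (s • x + c) - f x) 2 (volume.restrict K) ≤ ENNReal.ofReal ε := by
  obtain ⟨g, hgc, hfg, hg, hgm⟩ := hf.exists_hasCompactSupport_eLpNorm_sub_le (by simp)
    (ε := ENNReal.ofReal (ε / 4)) (by simpa using hε)
  have hfin : volume K ≠ ⊤ := hK.measure_lt_top.ne
  -- `V` turns a uniform bound on `K` into an `L²` bound; `V + 1` is used as denominator because `K`
  -- may be null.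
  set V : ℝ := (volume.real K) ^ (2 : ℝ)⁻¹ with hV
  have hV0 : 0 ≤ V := by positivity
  obtain ⟨δ, hδ, hgδ⟩ := Metric.uniformContinuous_iff.1
    (hgc.uniformContinuous_of_continuous hg) (ε / (4 * (V + 1))) (by positivity)
  obtain ⟨R, hR, hKR⟩ := hK.exists_pos_norm_le
  refine ⟨δ / (R + 1), by positivity, fun s hs hs1 c hc => ?_⟩
  have hsplit : (fun x => f (s • x + c) - f x) = (fun x => (f - g) (s • x + c))
      + ((fun x => g (s • x + c) - g x) + (g - f)) := by
    ext x; simp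
  have hs0 : s ≠ 0 := by linarith
  have hm1 : AEStronglyMeasurable (fun x => (f - g) (s • x + c)) (volume.restrict K) := by
    refine AEStronglyMeasurable.restrict ?_
    refine AEStronglyMeasurable.comp_aemeasurable (f := fun x : Plane => s • x + c) ?_ (by fun_prop)
    rw [map_affine_volume hs0]
    exact (hf.1.sub hgm.1).smul_measure _
  have hm2 : AEStronglyMeasurable (fun x => g (s • x + c) - g x) (volume.restrict K) :=
    Continuous.aestronglyMeasurable (by fun_prop)
  rw [hsplit]
  refine (eLpNorm_add_le hm1 (hm2.add (hgm.1.sub hf.1).restrict) one_le_two).trans ?_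
  have h1 : eLpNorm (fun x => (f - g) (s • x + c)) 2 (volume.restrict K)
      ≤ ENNReal.ofReal (ε / 2) := by
    refine (eLpNorm_restrict_le _ _ _ _).trans ((eLpNorm_comp_affine_le _ hs c).trans ?_)
    refine (mul_le_mul_right hfg 2).trans_eq ?_
    rw [← ENNReal.ofReal_ofNat, ← ENNReal.ofReal_mul (by norm_num)]
    congr 1; ring
  have h2 : eLpNorm (fun x => g (s • x + c) - g x) 2 (volume.restrict K)
      ≤ ENNReal.ofReal (ε / 4) := by
    have hae : ∀ᵐ x ∂volume.restrict K, ‖g (s • x + c) - g x‖ ≤ ε / (4 * (V + 1)) := by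
      have hKc : MeasurableSet (closure K) := isClosed_closure.measurableSet
      filter_upwards [ae_mono (Measure.restrict_mono subset_closure le_rfl)
        (ae_restrict_mem hKc)] with x hx
      have hxR : ‖x‖ ≤ R := by
        have : closure K ⊆ Metric.closedBall 0 R :=
          closure_minimal (fun y hy => by simpa using hKR y hy) Metric.isClosed_closedBall
        simpa using this hx
      rw [← dist_eq_norm]
      refine (hgδ ?_).le
      rw [dist_eq_norm]
      calc ‖s • x + c - x‖ = ‖(s - 1) • x + c‖ := by congr 1; module
        _ ≤ |s - 1| * ‖x‖ + ‖c‖ := (norm_add_le _ _).trans (by rw [norm_smul, Real.norm_eq_abs])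
        _ ≤ |s - 1| * R + ‖c‖ := by gcongr
        _ < δ / (R + 1) * R + δ / (R + 1) := by
            exact add_lt_add_of_le_of_lt (by gcongr) hc
        _ = δ := by field_simp
    refine (eLpNorm_le_of_ae_bound hae).trans ?_
    rw [Measure.restrict_apply_univ, ← ENNReal.ofReal_toReal hfin, ENNReal.toReal_ofNat,
      ENNReal.ofReal_rpow_of_nonneg ENNReal.toReal_nonneg (by norm_num),
      ← ENNReal.ofReal_mul (by positivity)]
    refine ENNReal.ofReal_le_ofReal ?_
    change V * _ ≤ _
    rw [← mul_div_assoc, div_le_div_iff₀ (by positivity) (by positivity)]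
    nlinarith
  have h3 : eLpNorm (g - f) 2 (volume.restrict K) ≤ ENNReal.ofReal (ε / 4) := by
    refine (eLpNorm_restrict_le _ _ _ _).trans ?_
    rwa [← neg_sub, eLpNorm_neg]
  calc _ ≤ ENNReal.ofReal (ε / 2) + (ENNReal.ofReal (ε / 4) + ENNReal.ofReal (ε / 4)) :=
        add_le_add h1 ((eLpNorm_add_le hm2 (hgm.1.sub hf.1).restrict one_le_two).trans
          (add_le_add h2 h3))
    _ = ENNReal.ofReal ε := by
        rw [← ENNReal.ofReal_add (by positivity) (by positivity),
          ← ENNReal.ofReal_add (by positivity) (by positivity)]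
        congr 1; ring

/-- Mollification composed with a dilation, both tending to the identity, converges in `L²`. -/
theorem tendsto_eLpNorm_mollify_affine_sub {E : Type*} [NormedAddCommGroup E] [NormedSpace ℝ E]
    [CompleteSpace E] {f : Plane → E} (hfm : StronglyMeasurable f) (hf : MemLp f 2 volume)
    {K : Set Plane}
    (hK : Bornology.IsBounded K) (ρ : ℕ → ContDiffBump (0 : Plane)) {s : ℕ → ℝ} {c : ℕ → Plane}
    (hρ : Tendsto (fun n => (ρ n).rOut) atTop (𝓝 0)) (hs : Tendsto s atTop (𝓝 1))
    (hs2 : ∀ n, 1 / 2 ≤ s n) (hc : Tendsto c atTop (𝓝 0)) :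
    Tendsto (fun n => eLpNorm
      (fun x => (∫ y, (ρ n).normed volume y • f (s n • x + c n - y)) - f x) 2
      (volume.restrict K)) atTop (𝓝 0) := by
  rw [ENNReal.tendsto_nhds_zero]
  intro ε hε
  obtain ⟨r, hr, hrε⟩ : ∃ r : ℝ, 0 < r ∧ ENNReal.ofReal r ≤ ε := by
    rcases eq_or_ne ε ∞ with rfl | h
    · exact ⟨1, one_pos, le_top⟩
    · exact ⟨ε.toReal, ENNReal.toReal_pos hε.ne' h, ENNReal.ofReal_toReal_le⟩
  obtain ⟨δ, hδ, H⟩ := eLpNorm_comp_affine_sub_le hf hK hr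
  have hs' : ∀ᶠ n in atTop, |s n - 1| < δ := by
    simpa [Real.dist_eq] using (Metric.tendsto_nhds.1 hs) δ hδ
  have hc' : ∀ᶠ n in atTop, ‖c n‖ < δ / 2 := by
    simpa using (Metric.tendsto_nhds.1 hc) (δ / 2) (by positivity)
  have hρ' : ∀ᶠ n in atTop, (ρ n).rOut < δ / 2 := hρ.eventually (gt_mem_nhds (by positivity))
  filter_upwards [hs', hc', hρ'] with n h1 h2 h3
  refine le_trans ?_ hrε
  set k := (ρ n).normed volume with hk
  have hk0 : ∀ y, 0 ≤ k y := fun y => (ρ n).nonneg_normed y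
  have hkc : Continuous k := (ρ n).continuous_normed
  have hkm : Measurable fun y => ENNReal.ofReal (k y) := hkc.measurable.ennreal_ofReal
  -- With the kernel as the density of a probability measure, the error is an average of the
  -- differences `f (s n • x + c n - y) - f x` over `‖y‖ < rOut`, each of them small in `L²`.
  set ν := (volume : Measure Plane).withDensity fun y => ENNReal.ofReal (k y) with hν
  have : IsProbabilityMeasure ν := ⟨by
    rw [hν, withDensity_apply _ MeasurableSet.univ, Measure.restrict_univ,
      ← ofReal_integral_eq_lintegral_ofReal (ρ n).integrable_normed (.of_forall hk0),
      (ρ n).integral_normed, ENNReal.ofReal_one]⟩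
  have hint : ∀ h : Plane → E, ∫ y, h y ∂ν = ∫ y, k y • h y := by
    intro h
    rw [hν, integral_withDensity_eq_integral_toReal_smul hkm (.of_forall fun _ => by simp)]
    simp [ENNReal.toReal_ofReal (hk0 _)]
  have heq : (fun x => (∫ y, k y • f (s n • x + c n - y)) - f x)
      = fun x => ∫ y, (f (s n • x + c n - y) - f x) ∂ν := by
    ext x
    have hkL : MemLp k 2 volume := hkc.memLp_of_hasCompactSupport (ρ n).hasCompactSupport_normed
    have hfL : MemLp (fun y => f (s n • x + c n - y)) 2 volume :=
      hf.comp_measurePreserving (Measure.measurePreserving_sub_left volume _)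
    rw [hint]
    simp_rw [smul_sub]
    rw [integral_sub, integral_smul_const, (ρ n).integral_normed, one_smul]
    · exact integrable_bilin (ContinuousLinearMap.lsmul ℝ ℝ) hkL hfL
    · exact (ρ n).integrable_normed.smul_const _
  rw [heq]
  refine eLpNorm_integral_le_of_ae_le ?_ ?_
  · refine StronglyMeasurable.sub ?_ (hfm.comp_measurable measurable_fst)
    exact hfm.comp_measurable (by fun_prop)
  · have hsupp : ∀ᵐ y ∂ν, ‖y‖ < (ρ n).rOut := by
      rw [hν, ae_withDensity_iff hkm]
      refine .of_forall fun y hy => ?_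
      have : y ∈ Function.support k := fun h => hy (by simp [h])
      rw [hk, (ρ n).support_normed_eq] at this
      simpa using this
    filter_upwards [hsupp] with y hy
    have := H (s n) (hs2 n) h1 (c n - y) ((norm_sub_le _ _).trans_lt (by linarith))
    simpa [add_sub_assoc] using this

/-! ### Smooth approximation in `H¹` of a convex domain -/

section Mollification

open scoped Convolution

theorem HasH1Gradient.congr_ae {D : Set Plane} {u u' : Plane → ℝ} {G G' : Plane → Plane}
    (h : HasH1Gradient D u G) (hu : u =ᵐ[volume.restrict D] u')
    (hG : G =ᵐ[volume.restrict D] G') : HasH1Gradient D u' G' where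
  memLp := (memLp_congr_ae hu).1 h.memLp
  memLp_gradient := (memLp_congr_ae hG).1 h.memLp_gradient
  weak_gradient φ hφ := by
    have h1 : ∫ x in D, u' x • ∇ φ x = ∫ x in D, u x • ∇ φ x :=
      integral_congr_ae (hu.symm.mono fun x hx => by simp only [hx])
    have h2 : ∫ x in D, φ x • G' x = ∫ x in D, φ x • G x :=
      integral_congr_ae (hG.symm.mono fun x hx => by simp only [hx])
    rw [h1, h2]
    exact h.weak_gradient φ hφ

/-- At points away from the boundary, the gradient of a mollification is the mollification of the
weak gradient. -/
theorem HasH1Gradient.gradient_convolution {K : Set Plane} (hK : IsOpen K)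
    (hKb : Bornology.IsBounded K) {u : Plane → ℝ} {G : Plane → Plane} (h : HasH1Gradient K u G)
    (ρ : ContDiffBump (0 : Plane)) {z : Plane} (hz : Metric.closedBall z ρ.rOut ⊆ K) :
    HasGradientAt (fun z => ∫ y, ρ.normed volume y • K.indicator u (z - y))
      (∫ y, ρ.normed volume y • K.indicator G (z - y)) z := by
  set k := ρ.normed volume with hk
  have hkc : ContDiff ℝ ∞ k := ρ.contDiff_normed
  have hks : HasCompactSupport k := ρ.hasCompactSupport_normed
  have : IsFiniteMeasure (volume.restrict K) := ⟨by simpa using hKb.measure_lt_top⟩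
  have hui : LocallyIntegrable (K.indicator u) volume :=
    ((integrable_indicator_iff hK.measurableSet).2 h.memLp.integrable_two).locallyIntegrable
  have hconv : (fun z => ∫ y, k y • K.indicator u (z - y))
      = (K.indicator u ⋆[ContinuousLinearMap.lsmul ℝ ℝ, volume] k) := by
    ext z
    rw [convolution_eq_swap]
    simp [mul_comm]
  have hfd := hks.hasFDerivAt_convolution_right (ContinuousLinearMap.lsmul ℝ ℝ) hui
    (hkc.of_le (by simp)) z
  rw [← hconv] at hfd
  rw [hasGradientAt_iff_hasFDerivAt]
  refine hfd.congr_fderiv (Eq.symm ?_)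
  -- The reflected kernel centred at `z` is admissible in the weak gradient identity exactly because
  -- the ball lies in `K`. The sign from the reflection cancels the sign of that identity.
  have hψ : IsTestFunction K (fun t => k (z - t)) := by
    have hc : HasCompactSupport (fun t => k (z - t)) :=
      hks.comp_homeomorph (Homeomorph.subLeft z)
    refine ⟨hkc.comp (contDiff_const.sub contDiff_id), hc, ?_⟩
    refine (closure_minimal (fun t ht => ?_) Metric.isClosed_closedBall).trans hz
    have ht' : z - t ∈ Function.support k := ht
    rw [hk, ρ.support_normed_eq] at ht'
    rw [Metric.mem_closedBall, dist_comm, dist_eq_norm]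
    simpa using (mem_ball_zero_iff.1 ht').le
  have hgrad : ∀ t, ∇ (fun t => k (z - t)) t = -∇ k (z - t) := by
    intro t
    have h1 : HasFDerivAt (fun t => k (z - t)) ((fderiv ℝ k (z - t)).comp
        (-ContinuousLinearMap.id ℝ Plane)) t :=
      HasFDerivAt.comp t (hkc.differentiable (by simp) _).hasFDerivAt
        ((hasFDerivAt_id t).const_sub z)
    rw [gradient, h1.fderiv]
    simp [gradient]
  have hw := h.weak_gradient _ hψ
  simp only [hgrad, smul_neg, integral_neg, neg_inj] at hw
  have h1 : ∫ y, k y • K.indicator G (z - y) = ∫ t in K, k (z - t) • G t := by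
    rw [← integral_indicator hK.measurableSet, ← integral_sub_left_eq_self _ volume z]
    refine integral_congr_ae (.of_forall fun t => ?_)
    by_cases ht : t ∈ K <;> simp [ht]
  rw [h1, ← hw]
  have h2 : ∫ t in K, u t • ∇ k (z - t) = (InnerProductSpace.toDual ℝ Plane).symm
      (∫ t in K, u t • fderiv ℝ k (z - t)) := by
    have := ((InnerProductSpace.toDual ℝ Plane).symm.toContinuousLinearEquiv :
      StrongDual ℝ Plane ≃L[ℝ] Plane).integral_comp_comm (μ := volume.restrict K)
      (fun t => u t • fderiv ℝ k (z - t))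
    simpa [gradient] using this
  rw [h2, LinearIsometryEquiv.apply_symm_apply, ← integral_indicator hK.measurableSet]
  rw [convolution_def]
  refine integral_congr_ae (.of_forall fun t => ?_)
  by_cases ht : t ∈ K <;> simp [ht, ContinuousLinearMap.precompR]
  ext v
  simp

/-- Contracting `K` towards an interior point `x₀` by the factor `1 - θ` leaves a margin
proportional to `θ` to the boundary. Mollifying at a smaller scale then uses only values inside `K`,
so the gradient of the mollification is that of the weak gradient up to the factor `1 - θ`, and the
approximants are smooth on the whole plane. -/
theorem HasH1Gradient.exists_smooth_approx {K : Set Plane} (hK : IsOpen K)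
    (hKb : Bornology.IsBounded K) (hKc : Convex ℝ K) (hne : K.Nonempty) {u : Plane → ℝ}
    {G : Plane → Plane} (h : HasH1Gradient K u G) :
    ∃ φ : ℕ → Plane → ℝ, (∀ n, ContDiff ℝ ∞ (φ n)) ∧
      Tendsto (fun n => eLpNorm (fun x => φ n x - u x) 2 (volume.restrict K)) atTop (𝓝 0) ∧
      Tendsto (fun n => eLpNorm (fun x => ∇ (φ n) x - G x) 2 (volume.restrict K)) atTop (𝓝 0) := by
  -- The averaging argument needs joint measurability in `(x, y)`, hence genuinely measurable
  -- representatives.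
  wlog hmeas : StronglyMeasurable u ∧ StronglyMeasurable G generalizing u G
  · obtain ⟨φ, h1, h2, h3⟩ := this (h.congr_ae h.memLp.1.ae_eq_mk h.memLp_gradient.1.ae_eq_mk)
      ⟨h.memLp.1.stronglyMeasurable_mk, h.memLp_gradient.1.stronglyMeasurable_mk⟩
    refine ⟨φ, h1, h2.congr fun n => ?_, h3.congr fun n => ?_⟩
    · exact eLpNorm_congr_ae (h.memLp.1.ae_eq_mk.mono fun x hx => by simp only [hx])
    · exact eLpNorm_congr_ae (h.memLp_gradient.1.ae_eq_mk.mono fun x hx => by simp only [hx])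
  obtain ⟨x₀, hx₀⟩ := hne
  obtain ⟨r, hr, hrK⟩ := Metric.isOpen_iff.1 hK x₀ hx₀
  -- The shift by `2` keeps the dilation factor `1 - θ n` at least `1 / 2`, as the dilation estimate
  -- requires.
  set θ : ℕ → ℝ := fun n => 1 / ((n : ℝ) + 2) with hθ
  have hθ0 : ∀ n, 0 < θ n := fun n => by positivity
  have hθ1 : ∀ n, θ n ≤ 1 / 2 := fun n =>
    one_div_le_one_div_of_le two_pos (by linarith [n.cast_nonneg (α := ℝ)])
  have hθlim : Tendsto θ atTop (𝓝 0) := by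
    refine tendsto_const_nhds.div_atTop ?_
    exact tendsto_atTop_add_const_right _ _ tendsto_natCast_atTop_atTop
  set s : ℕ → ℝ := fun n => 1 - θ n with hs
  set c : ℕ → Plane := fun n => θ n • x₀ with hc
  let ρ : ℕ → ContDiffBump (0 : Plane) := fun n =>
    ⟨θ n * r / 4, θ n * r / 2, by have := hθ0 n; positivity, by
      have : 0 < θ n * r := mul_pos (hθ0 n) hr
      linarith⟩
  have hs2 : ∀ n, 1 / 2 ≤ s n := fun n => by have := hθ1 n; simp only [hs]; linarith
  have hs1 : ∀ n, s n ≤ 1 := fun n => by have := hθ0 n; simp only [hs]; linarith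
  have hslim : Tendsto s atTop (𝓝 1) := by simpa using hθlim.const_sub 1
  have hclim : Tendsto c atTop (𝓝 0) := by simpa using hθlim.smul_const x₀
  have hρlim : Tendsto (fun n => (ρ n).rOut) atTop (𝓝 0) := by
    have := (hθlim.mul_const r).div_const 2
    simpa using this
  have hin : ∀ n, ∀ x ∈ K, Metric.closedBall (s n • x + c n) (ρ n).rOut ⊆ K := by
    intro n x hx y hy
    rw [Metric.mem_closedBall, dist_eq_norm] at hy
    have hy' : ‖y - (s n • x + c n)‖ ≤ θ n * r / 2 := hy
    -- A point `y` of the small ball is the convex combination, with weights `s n` and `θ n`, of `x`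
    -- and this point of the ball of radius `r` about `x₀`.
    have hx' : x₀ + (θ n)⁻¹ • (y - (s n • x + c n)) ∈ K := by
      refine hrK ?_
      rw [mem_ball_iff_norm, add_sub_cancel_left, norm_smul, norm_inv,
        Real.norm_of_nonneg (hθ0 n).le, inv_mul_lt_iff₀ (hθ0 n)]
      have : 0 < θ n * r := mul_pos (hθ0 n) hr
      linarith
    have := hKc hx hx' (a := s n) (b := θ n) (by linarith [hs2 n]) (hθ0 n).le (by simp [hs])
    convert this using 1
    rw [smul_add, smul_inv_smul₀ (hθ0 n).ne']
    simp only [hc]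
    abel
  have hum : MemLp (K.indicator u) 2 volume := (memLp_indicator_iff_restrict hK.measurableSet).2 h.memLp
  have hGm : MemLp (K.indicator G) 2 volume :=
    (memLp_indicator_iff_restrict hK.measurableSet).2 h.memLp_gradient
  have hum' := hmeas.1.indicator hK.measurableSet
  have hGm' := hmeas.2.indicator hK.measurableSet
  have hφs : ∀ n, ContDiff ℝ ∞ fun z => ∫ y, (ρ n).normed volume y • K.indicator u (z - y) := by
    intro n
    refine (ρ n).hasCompactSupport_normed.contDiff_convolution_left (ContinuousLinearMap.lsmul ℝ ℝ)
      (ρ n).contDiff_normed (n := ⊤) ?_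
    exact hum.locallyIntegrable one_le_two
  refine ⟨fun n x => ∫ y, (ρ n).normed volume y • K.indicator u (s n • x + c n - y),
    fun n => (hφs n).comp (by fun_prop), ?_, ?_⟩
  · refine (tendsto_eLpNorm_mollify_affine_sub hum' hum hKb ρ hρlim hslim hs2 hclim).congr
      fun n => eLpNorm_congr_ae ?_
    filter_upwards [ae_restrict_mem hK.measurableSet] with x hx
    rw [indicator_of_mem hx]
  · have hlim := tendsto_eLpNorm_mollify_affine_sub hGm' hGm hKb ρ hρlim hslim hs2 hclim
    have hlim2 : Tendsto (fun n => ‖θ n‖ₑ * eLpNorm G 2 (volume.restrict K)) atTop (𝓝 0) := by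
      have h1 : Tendsto (fun n => ‖θ n‖ₑ) atTop (𝓝 0) := by
        simpa [Function.comp_def] using (continuous_enorm.tendsto (0 : ℝ)).comp hθlim
      simpa using ENNReal.Tendsto.mul_const h1 (Or.inr h.memLp_gradient.2.ne)
    refine tendsto_of_tendsto_of_tendsto_of_le_of_le tendsto_const_nhds
      (by simpa using hlim.add hlim2) (fun _ => zero_le) fun n => ?_
    set M : Plane → Plane := fun x => ∫ y, (ρ n).normed volume y • K.indicator G (s n • x + c n - y)
      with hM
    have hgr : ∀ x ∈ K, ∇ (fun x => ∫ y, (ρ n).normed volume y • K.indicator u (s n • x + c n - y)) x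
        = s n • M x := by
      intro x hx
      have h1 := (h.gradient_convolution hK hKb (ρ n) (hin n x hx)).hasFDerivAt
      have h2 : HasFDerivAt (fun x : Plane => s n • x + c n)
          (s n • ContinuousLinearMap.id ℝ Plane) x :=
        ((hasFDerivAt_id x).fun_const_smul _).add_const _
      have h3 := h1.comp x h2
      have h4 : fderiv ℝ (fun x => ∫ y, (ρ n).normed volume y • K.indicator u (s n • x + c n - y)) x
        = _ := h3.fderiv
      rw [gradient, h4]
      simp [hM]
    have hMm : AEStronglyMeasurable M (volume.restrict K) := by
      have : StronglyMeasurable (Function.uncurry fun x y =>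
          (ρ n).normed volume y • K.indicator G (s n • x + c n - y)) :=
        ((ρ n).continuous_normed.stronglyMeasurable.comp_measurable measurable_snd).smul
          (hGm'.comp_measurable (by fun_prop))
      exact this.integral_prod_right.aestronglyMeasurable
    have heq : (fun x => ∇ (fun x => ∫ y, (ρ n).normed volume y •
        K.indicator u (s n • x + c n - y)) x - G x) =ᵐ[volume.restrict K]
        s n • (fun x => M x - K.indicator G x) + (-θ n) • G := by
      filter_upwards [ae_restrict_mem hK.measurableSet] with x hx
      rw [hgr x hx]
      simp only [Pi.add_apply, Pi.smul_apply, indicator_of_mem hx, hs]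
      module
    rw [eLpNorm_congr_ae heq]
    have hMG : AEStronglyMeasurable (fun x => M x - K.indicator G x) (volume.restrict K) :=
      hMm.sub hGm'.aestronglyMeasurable
    refine (eLpNorm_add_le (hMG.const_smul _) (h.memLp_gradient.1.const_smul _) one_le_two).trans ?_
    rw [eLpNorm_const_smul, eLpNorm_const_smul, enorm_neg]
    gcongr
    refine mul_le_of_le_one_left' ?_
    rw [Real.enorm_eq_ofReal (by linarith [hs2 n])]
    simpa using hs1 n

end Mollification

/-! ### The Poincaré inequality -/

theorem enorm_integral_pow_two_le {α E : Type*} [MeasurableSpace α] [NormedAddCommGroup E]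
    [NormedSpace ℝ E] {ν : Measure α} [IsProbabilityMeasure ν] {f : α → E}
    (hf : AEStronglyMeasurable f ν) : ‖∫ x, f x ∂ν‖ₑ ^ 2 ≤ ∫⁻ x, ‖f x‖ₑ ^ 2 ∂ν := by
  rw [← eLpNorm_two_pow]
  gcongr
  refine (enorm_integral_le_lintegral_enorm _).trans ?_
  rw [← eLpNorm_one_eq_lintegral_enorm]
  exact eLpNorm_le_eLpNorm_of_exponent_le one_le_two hf

theorem eLpNorm_const_average_le {α : Type*} [MeasurableSpace α] {μ : Measure α}
    [IsFiniteMeasure μ] {v : α → ℝ} (hv : AEStronglyMeasurable v μ) :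
    eLpNorm (fun _ => ⨍ y, v y ∂μ) 2 μ ≤ eLpNorm v 2 μ := by
  rcases eq_or_ne μ 0 with rfl | hμ
  · simp
  have : NeZero μ := ⟨hμ⟩
  have hμ' : μ univ ≠ 0 := by simpa using hμ
  rw [← ENNReal.pow_le_pow_left_iff two_ne_zero, eLpNorm_two_pow, eLpNorm_two_pow, lintegral_const]
  calc ‖⨍ y, v y ∂μ‖ₑ ^ 2 * μ univ
      ≤ (∫⁻ x, ‖v x‖ₑ ^ 2 ∂((μ univ)⁻¹ • μ)) * μ univ := by
        gcongr
        exact enorm_integral_pow_two_le (hv.smul_measure _)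
    _ = ∫⁻ x, ‖v x‖ₑ ^ 2 ∂μ := by
        rw [lintegral_smul_measure, smul_eq_mul, mul_right_comm,
          ENNReal.inv_mul_cancel hμ' (measure_ne_top _ _), one_mul]

theorem eLpNorm_sub_average_le {α : Type*} [MeasurableSpace α] {μ : Measure α}
    [IsFiniteMeasure μ] {v : α → ℝ} (hv : AEStronglyMeasurable v μ) :
    eLpNorm (fun x => v x - ⨍ y, v y ∂μ) 2 μ ≤ 2 * eLpNorm v 2 μ := by
  refine (eLpNorm_sub_le hv aestronglyMeasurable_const one_le_two).trans ?_
  rw [two_mul]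
  gcongr
  exact eLpNorm_const_average_le hv

/-- Convexity keeps the image of `K` inside `K`, and the Jacobian factor `s⁻²` is at most `4`. -/
theorem lintegral_convex_comb_le {K : Set Plane} (hK : IsOpen K) (hKc : Convex ℝ K)
    (h : Plane → ℝ≥0∞) {s : ℝ} (hs : 1 / 2 ≤ s) (hs1 : s ≤ 1) {y : Plane} (hy : y ∈ K) :
    ∫⁻ x in K, h (s • x + (1 - s) • y) ≤ 4 * ∫⁻ x in K, h x := by
  have hs0 : 0 < s := by linarith
  calc ∫⁻ x in K, h (s • x + (1 - s) • y)
      ≤ ∫⁻ x in K, K.indicator h (s • x + (1 - s) • y) := by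
        refine setLIntegral_mono' hK.measurableSet fun x hx => ?_
        rw [indicator_of_mem (hKc hx hy hs0.le (by linarith) (by ring))]
    _ ≤ ∫⁻ x, K.indicator h (s • x + (1 - s) • y) := setLIntegral_le_lintegral _ _
    _ = ENNReal.ofReal |(s ^ 2)⁻¹| * ∫⁻ x in K, h x := by
        rw [← (measurableEmbedding_affine hs0.ne' ((1 - s) • y)).lintegral_map,
          map_affine_volume hs0.ne', lintegral_smul_measure, lintegral_indicator hK.measurableSet,
          smul_eq_mul]
    _ ≤ 4 * ∫⁻ x in K, h x := by
        gcongr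
        rw [abs_of_pos (by positivity), ← ENNReal.ofReal_ofNat]
        refine ENNReal.ofReal_le_ofReal ?_
        rw [inv_le_comm₀ (by positivity) (by norm_num)]
        nlinarith

/-- Integrate the derivative along the segment from `y` to `x`, apply Jensen's inequality, and
exchange the order of integration so that the segment parameter `s` is outermost. -/
theorem lintegral_prod_sub_le_gradient {K : Set Plane} (hK : IsOpen K)
    (hKc : Convex ℝ K) {d : ℝ} (hd0 : 0 ≤ d) (hd : ∀ x ∈ K, ∀ y ∈ K, ‖x - y‖ ≤ d)
    {φ : Plane → ℝ} (hφ : ContDiff ℝ ∞ φ) :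
    ∫⁻ x in K, ∫⁻ y in K, ‖φ x - φ y‖ₑ ^ 2
      ≤ volume K * (4 * ENNReal.ofReal d ^ 2 * ∫⁻ x in K, ‖∇ φ x‖ₑ ^ 2) := by
  have hgc := hφ.continuous_gradient
  have hγ : Measurable fun z => ‖∇ φ z‖ₑ ^ 2 := hgc.measurable.enorm.pow_const 2
  have hpt : ∀ x ∈ K, ∀ y ∈ K, ‖φ x - φ y‖ₑ ^ 2
      ≤ ENNReal.ofReal d ^ 2 * ∫⁻ s in Icc (0 : ℝ) 1, ‖∇ φ (s • x + (1 - s) • y)‖ₑ ^ 2 := by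
    intro x hx y hy
    have hder : ∀ s ∈ uIcc (0 : ℝ) 1, HasDerivAt (fun s : ℝ => φ (s • x + (1 - s) • y))
        (inner ℝ (∇ φ (s • x + (1 - s) • y)) (x - y)) s := by
      intro s _
      have h1 : HasDerivAt (fun s : ℝ => s • x + (1 - s) • y) (x - y) s := by
        have := ((hasDerivAt_id s).smul_const x).fun_add
          (((hasDerivAt_id s).const_sub 1).smul_const y)
        simpa [sub_eq_add_neg] using this
      have := ((hφ.differentiable (by simp)) (s • x + (1 - s) • y)).hasFDerivAt.comp_hasDerivAt s h1
      rwa [← inner_gradient_left] at this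
    have hcont : Continuous fun s : ℝ => inner ℝ (∇ φ (s • x + (1 - s) • y)) (x - y) := by
      fun_prop
    have hFTC := intervalIntegral.integral_eq_sub_of_hasDerivAt hder (hcont.intervalIntegrable _ _)
    simp only [one_smul, sub_self, zero_smul, add_zero, sub_zero, zero_add] at hFTC
    rw [← hFTC, intervalIntegral.integral_of_le zero_le_one, ← integral_Icc_eq_integral_Ioc]
    have : IsProbabilityMeasure (volume.restrict (Icc (0 : ℝ) 1)) := ⟨by simp⟩
    refine (enorm_integral_pow_two_le hcont.aestronglyMeasurable).trans ?_
    rw [← lintegral_const_mul' _ _ (show ENNReal.ofReal d ^ 2 ≠ ⊤ by simp)]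
    refine lintegral_mono fun s => ?_
    rw [← mul_pow]
    gcongr
    rw [← ofReal_norm, ← ofReal_norm, ← ENNReal.ofReal_mul hd0]
    refine ENNReal.ofReal_le_ofReal ((norm_inner_le_norm _ _).trans ?_)
    rw [mul_comm]
    gcongr
    exact hd x hx y hy
  set I := ∫⁻ x in K, ‖∇ φ x‖ₑ ^ 2 with hI
  have hslice : ∀ s ∈ Icc (0 : ℝ) 1,
      ∫⁻ x in K, ∫⁻ y in K, ‖∇ φ (s • x + (1 - s) • y)‖ₑ ^ 2 ≤ volume K * (4 * I) := by
    intro s hs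
    -- Substitute in whichever endpoint has weight at least `1 / 2`, so that the Jacobian stays
    -- bounded for every `s`.
    rcases le_total (1 / 2) s with h | h
    · rw [lintegral_lintegral_swap (f := fun x y => ‖∇ φ (s • x + (1 - s) • y)‖ₑ ^ 2)
        (hγ.comp (by fun_prop : Measurable fun p : Plane × Plane => s • p.1 + (1 - s) • p.2)).aemeasurable]
      calc _ ≤ ∫⁻ _ in K, 4 * I := setLIntegral_mono' hK.measurableSet fun y hy =>
            lintegral_convex_comb_le hK hKc (fun x => ‖∇ φ x‖ₑ ^ 2) h hs.2 hy
        _ = _ := by rw [setLIntegral_const, mul_comm]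
    · calc _ ≤ ∫⁻ _ in K, 4 * I := setLIntegral_mono' hK.measurableSet fun x hx => by
            have := lintegral_convex_comb_le hK hKc (fun x => ‖∇ φ x‖ₑ ^ 2) (s := 1 - s)
              (by linarith) (by linarith [hs.1]) hx
            simpa [add_comm] using this
        _ = _ := by rw [setLIntegral_const, mul_comm]
  calc ∫⁻ x in K, ∫⁻ y in K, ‖φ x - φ y‖ₑ ^ 2
      ≤ ∫⁻ x in K, ∫⁻ y in K, ENNReal.ofReal d ^ 2 *
          ∫⁻ s in Icc (0 : ℝ) 1, ‖∇ φ (s • x + (1 - s) • y)‖ₑ ^ 2 :=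
        setLIntegral_mono' hK.measurableSet fun x hx =>
          setLIntegral_mono' hK.measurableSet fun y hy => hpt x hx y hy
    _ = ENNReal.ofReal d ^ 2 * ∫⁻ s in Icc (0 : ℝ) 1, ∫⁻ x in K, ∫⁻ y in K,
          ‖∇ φ (s • x + (1 - s) • y)‖ₑ ^ 2 := by
        simp_rw [lintegral_const_mul' _ _ (show ENNReal.ofReal d ^ 2 ≠ ⊤ by simp)]
        congr 1
        rw [lintegral_lintegral_swap (f := fun (s : ℝ) x => ∫⁻ y in K, ‖∇ φ (s • x + (1 - s) • y)‖ₑ ^ 2)]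
        · refine lintegral_congr fun x => ?_
          rw [lintegral_lintegral_swap (f := fun (s : ℝ) y => ‖∇ φ (s • x + (1 - s) • y)‖ₑ ^ 2)
            (hγ.comp (by fun_prop : Measurable fun p : ℝ × Plane => p.1 • x + (1 - p.1) • p.2)).aemeasurable]
        · refine Measurable.aemeasurable ?_
          exact Measurable.lintegral_prod_right' (f := fun p : (ℝ × Plane) × Plane =>
            ‖∇ φ (p.1.1 • p.1.2 + (1 - p.1.1) • p.2)‖ₑ ^ 2) (hγ.comp (by fun_prop))
    _ ≤ ENNReal.ofReal d ^ 2 * ∫⁻ s in Icc (0 : ℝ) 1, volume K * (4 * I) := by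
        gcongr 1
        exact setLIntegral_mono' measurableSet_Icc hslice
    _ = _ := by
        simp
        ring

/-- The deviation from the mean at `x` is the average of `φ x - φ y` over `y`; Jensen's inequality
reduces to the double integral, and `4 d² = (2 d)²`. -/
theorem ContDiff.poincare {K : Set Plane} (hK : IsOpen K) (hKb : Bornology.IsBounded K)
    (hKc : Convex ℝ K) {d : ℝ} (hd0 : 0 ≤ d) (hd : ∀ x ∈ K, ∀ y ∈ K, ‖x - y‖ ≤ d)
    {φ : Plane → ℝ} (hφ : ContDiff ℝ ∞ φ) :
    eLpNorm (fun x => φ x - ⨍ y in K, φ y) 2 (volume.restrict K)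
      ≤ ENNReal.ofReal (2 * d) * eLpNorm (∇ φ) 2 (volume.restrict K) := by
  rcases eq_or_ne (volume.restrict K) 0 with h0 | h0
  · simp [h0]
  have : NeZero (volume.restrict K) := ⟨h0⟩
  have : IsFiniteMeasure (volume.restrict K) := ⟨by simpa using hKb.measure_lt_top⟩
  have hV : volume K ≠ 0 := by simpa using h0
  have hV' : volume K ≠ ⊤ := hKb.measure_lt_top.ne
  rw [← ENNReal.pow_le_pow_left_iff two_ne_zero, eLpNorm_two_pow, mul_pow, eLpNorm_two_pow]
  have hi : Integrable φ (volume.restrict K) :=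
    (hφ.continuous.memLp_restrict hKb 2).integrable_two
  calc ∫⁻ x in K, ‖φ x - ⨍ y in K, φ y‖ₑ ^ 2
      ≤ ∫⁻ x in K, (volume K)⁻¹ * ∫⁻ y in K, ‖φ x - φ y‖ₑ ^ 2 := by
        refine lintegral_mono fun x => ?_
        have h1 : φ x - ⨍ y in K, φ y = ⨍ y in K, (φ x - φ y) := by
          rw [average, average, integral_sub (integrable_const _)]
          · have hV0 : volume.real K ≠ 0 := ENNReal.toReal_ne_zero.2 ⟨hV, hV'⟩
            simp [← measureReal_def, hV0]
          · exact hi.smul_measure (by simpa using hV)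
        rw [h1, average]
        refine (enorm_integral_pow_two_le ?_).trans ?_
        · exact (continuous_const.sub hφ.continuous).aestronglyMeasurable
        · rw [lintegral_smul_measure, smul_eq_mul, Measure.restrict_apply_univ]
    _ = (volume K)⁻¹ * ∫⁻ x in K, ∫⁻ y in K, ‖φ x - φ y‖ₑ ^ 2 := by
        rw [lintegral_const_mul' _ _ (by simpa using hV)]
    _ ≤ (volume K)⁻¹ * (volume K * (4 * ENNReal.ofReal d ^ 2 * ∫⁻ x in K, ‖∇ φ x‖ₑ ^ 2)) := by
        gcongr
        exact lintegral_prod_sub_le_gradient hK hKc hd0 hd hφ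
    _ = _ := by
        rw [← mul_assoc, ENNReal.inv_mul_cancel hV hV', one_mul, ENNReal.ofReal_mul two_pos.le,
          mul_pow]
        congr 2
        norm_num

/-- The Poincaré inequality on a bounded convex domain. -/
theorem HasH1Gradient.poincare {K : Set Plane} (hK : IsOpen K) (hKb : Bornology.IsBounded K)
    (hKc : Convex ℝ K) (hne : K.Nonempty) {d : ℝ} (hd0 : 0 ≤ d)
    (hd : ∀ x ∈ K, ∀ y ∈ K, ‖x - y‖ ≤ d) {u : Plane → ℝ} {G : Plane → Plane}
    (h : HasH1Gradient K u G) :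
    eLpNorm (fun x => u x - ⨍ y in K, u y) 2 (volume.restrict K)
      ≤ ENNReal.ofReal (2 * d) * eLpNorm G 2 (volume.restrict K) := by
  have : IsFiniteMeasure (volume.restrict K) := ⟨by simpa using hKb.measure_lt_top⟩
  obtain ⟨φ, hφ, hφu, hφG⟩ := h.exists_smooth_approx hK hKb hKc hne
  set C := ENNReal.ofReal (2 * d) with hC
  have hle : ∀ n, eLpNorm (fun x => u x - ⨍ y in K, u y) 2 (volume.restrict K)
      ≤ 2 * eLpNorm (fun x => φ n x - u x) 2 (volume.restrict K)
        + C * (eLpNorm (fun x => ∇ (φ n) x - G x) 2 (volume.restrict K)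
          + eLpNorm G 2 (volume.restrict K)) := by
    intro n
    have hm := ((hφ n).continuous.memLp_restrict hKb 2)
    have hG := ((hφ n).continuous_gradient.memLp_restrict hKb 2)
    -- Subtracting the mean is linear: the smooth part obeys the smooth inequality, and the
    -- approximation error loses at most a factor `2`.
    have hsplit : (fun x => u x - ⨍ y in K, u y)
        = (fun x => φ n x - ⨍ y in K, φ n y)
          - (fun x => (φ n x - u x) - ⨍ y in K, (φ n y - u y)) := by
      ext x
      simp only [Pi.sub_apply, average_eq, Measure.real]
      rw [integral_sub hm.integrable_two h.memLp.integrable_two, smul_sub]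
      ring
    have hG' : eLpNorm (∇ (φ n)) 2 (volume.restrict K)
        ≤ eLpNorm (fun x => ∇ (φ n) x - G x) 2 (volume.restrict K)
          + eLpNorm G 2 (volume.restrict K) := by
      have h1 : ∇ (φ n) = (fun x => ∇ (φ n) x - G x) + G := by ext1 x; simp
      conv_lhs => rw [h1]
      exact eLpNorm_add_le (hG.1.sub h.memLp_gradient.1) h.memLp_gradient.1 one_le_two
    rw [hsplit]
    refine (eLpNorm_sub_le (hm.1.sub aestronglyMeasurable_const)
      ((hm.1.sub h.memLp.1).sub aestronglyMeasurable_const) one_le_two).trans ?_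
    rw [add_comm]
    gcongr
    · exact eLpNorm_sub_average_le (hm.1.sub h.memLp.1)
    · exact ((hφ n).poincare hK hKb hKc hd0 hd).trans (by gcongr)
  have hlim : Tendsto (fun n => 2 * eLpNorm (fun x => φ n x - u x) 2 (volume.restrict K)
        + C * (eLpNorm (fun x => ∇ (φ n) x - G x) 2 (volume.restrict K)
          + eLpNorm G 2 (volume.restrict K))) atTop (𝓝 (C * eLpNorm G 2 (volume.restrict K))) := by
    have h1 := ENNReal.Tendsto.const_mul (a := 2) hφu (by simp)
    have h2 := ENNReal.Tendsto.const_mul (a := C)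
      (hφG.add (tendsto_const_nhds (x := eLpNorm G 2 (volume.restrict K)))) (Or.inr ENNReal.ofReal_ne_top)
    simpa using h1.add h2
  exact ge_of_tendsto' hlim hle

/-! ### Weak derivatives: testing, restriction and limits -/

/-- By density of smooth functions in `H¹(K)`. This permits testing the Neumann problem with its own
solution. -/
theorem HasH1Gradient.weak_form {K : Set Plane} (hK : IsOpen K) (hKb : Bornology.IsBounded K)
    (hKc : Convex ℝ K) (hne : K.Nonempty) {u : Plane → ℝ} {G : Plane → Plane}
    (h : HasH1Gradient K u G) {w : Plane → Plane} {g : Plane → ℝ}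
    (hw : MemLp w 2 (volume.restrict K)) (hg : MemLp g 2 (volume.restrict K))
    (h0 : ∀ φ : Plane → ℝ, ContDiff ℝ ∞ φ → normalTrace K w g φ = 0) :
    (∫ x in K, inner ℝ (w x) (G x)) + ∫ x in K, g x * u x = 0 := by
  obtain ⟨φ, hφ, hφu, hφG⟩ := h.exists_smooth_approx hK hKb hKc hne
  have hm := fun n => (hφ n).continuous.memLp_restrict hKb 2
  have hmG := fun n => (hφ n).continuous_gradient.memLp_restrict hKb 2
  have h1 := tendsto_integral_bilin (innerSL ℝ : Plane →L[ℝ] Plane →L[ℝ] ℝ)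
    (.of_forall hmG) h.memLp_gradient hw hφG
  have h2 := tendsto_integral_bilin (ContinuousLinearMap.mul ℝ ℝ) (.of_forall hm) h.memLp hg hφu
  have h3 : ∀ n, (∫ x in K, innerSL ℝ (∇ (φ n) x) (w x))
      + ∫ x in K, ContinuousLinearMap.mul ℝ ℝ (φ n x) (g x) = 0 := by
    intro n
    rw [← integral_add (integrable_bilin _ (hmG n) hw) (integrable_bilin _ (hm n) hg), ← h0 _ (hφ n)]
    refine integral_congr_ae (.of_forall fun x => ?_)
    change inner ℝ (∇ (φ n) x) (w x) + φ n x * g x = inner ℝ (w x) (∇ (φ n) x) + g x * φ n x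
    rw [real_inner_comm, mul_comm]
  have h4 := tendsto_nhds_unique (h1.add h2) (by simp only [h3]; exact tendsto_const_nhds)
  rw [← h4]
  congr 1
  · exact integral_congr_ae (.of_forall fun x => real_inner_comm _ _)
  · exact integral_congr_ae (.of_forall fun x => by simp [mul_comm])

theorem hasWeakDivergence_of_normalTrace {D : Set Plane} (hD : Bornology.IsBounded D)
    {w : Plane → Plane} {g : Plane → ℝ} (hw : MemLp w 2 (volume.restrict D))
    (hg : MemLp g 2 (volume.restrict D))
    (h : ∀ φ, IsTestFunction D φ → normalTrace D w g φ = 0) : HasWeakDivergence D w g where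
  memLp := hw
  memLp_div := hg
  weak_div φ hφ := by
    have h1 := h φ hφ
    rw [normalTrace, integral_add] at h1
    · linarith
    · exact integrable_bilin (innerSL ℝ) hw (hφ.1.continuous_gradient.memLp_restrict hD 2)
    · exact integrable_bilin (ContinuousLinearMap.mul ℝ ℝ) hg
        (hφ.1.continuous.memLp_restrict hD 2)

theorem normalTrace_sub {D : Set Plane} (hD : Bornology.IsBounded D) {w w' : Plane → Plane}
    {g g' φ : Plane → ℝ} (hw : MemLp w 2 (volume.restrict D))
    (hg : MemLp g 2 (volume.restrict D)) (hw' : MemLp w' 2 (volume.restrict D))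
    (hg' : MemLp g' 2 (volume.restrict D)) (hφ : ContDiff ℝ ∞ φ) :
    normalTrace D (fun x => w x - w' x) (fun x => g x - g' x) φ
      = normalTrace D w g φ - normalTrace D w' g' φ := by
  unfold normalTrace
  rw [← integral_sub (integrable_normalTrace hD hw hg hφ) (integrable_normalTrace hD hw' hg' hφ)]
  refine integral_congr_ae (.of_forall fun x => ?_)
  simp only [inner_sub_left]
  ring

theorem normalTrace_congr_ae {D : Set Plane} {w : Plane → Plane} {g g' φ : Plane → ℝ}
    (h : g =ᵐ[volume.restrict D] g') : normalTrace D w g φ = normalTrace D w g' φ :=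
  integral_congr_ae (h.mono fun x hx => by simp only [hx])

theorem HasH1Gradient.sub {D : Set Plane} (hD : Bornology.IsBounded D) {u u' : Plane → ℝ}
    {G G' : Plane → Plane} (h : HasH1Gradient D u G) (h' : HasH1Gradient D u' G') :
    HasH1Gradient D (fun x => u x - u' x) (fun x => G x - G' x) where
  memLp := h.memLp.sub h'.memLp
  memLp_gradient := h.memLp_gradient.sub h'.memLp_gradient
  weak_gradient φ hφ := by
    have hm := hφ.1.continuous.memLp_restrict hD 2
    have hmG := hφ.1.continuous_gradient.memLp_restrict hD 2
    simp only [sub_smul, smul_sub]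
    rw [integral_sub, integral_sub, h.weak_gradient φ hφ, h'.weak_gradient φ hφ]
    · abel
    · exact integrable_bilin (ContinuousLinearMap.lsmul ℝ ℝ) hm h.memLp_gradient
    · exact integrable_bilin (ContinuousLinearMap.lsmul ℝ ℝ) hm h'.memLp_gradient
    · exact integrable_bilin (ContinuousLinearMap.lsmul ℝ ℝ) h.memLp hmG
    · exact integrable_bilin (ContinuousLinearMap.lsmul ℝ ℝ) h'.memLp hmG

/-- Integration by parts against the constant `1`, one direction at a time. -/
theorem HasCompactSupport.integral_gradient_eq_zero {φ : Plane → ℝ} (hφ : ContDiff ℝ ∞ φ)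
    (hs : HasCompactSupport φ) : ∫ x, ∇ φ x = 0 := by
  have hint : Integrable (∇ φ) := by
    refine hφ.continuous_gradient.integrable_of_hasCompactSupport ?_
    exact hs.mono' fun x hx => by_contra fun h => hx (gradient_eq_zero_of_notMem_tsupport h)
  refine integral_eq_zero_of_forall_integral_inner_eq_zero (𝕜 := ℝ) _ hint fun c => ?_
  have h1 : ∀ x, inner ℝ c (∇ φ x) = 1 * fderiv ℝ φ x c := fun x => by
    rw [real_inner_comm, inner_gradient_left, one_mul]
  have hint' : Integrable fun x => 1 * fderiv ℝ φ x c := by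
    simpa only [h1] using hint.const_inner (𝕜 := ℝ) c
  simp_rw [h1]
  rw [integral_mul_fderiv_eq_neg_fderiv_mul_of_integrable (f := fun _ => (1 : ℝ)) (by simp) hint'
    (by simpa using hφ.continuous.integrable_of_hasCompactSupport hs)
    (fun _ _ => differentiableAt_const _) (fun x _ => hφ.differentiable (by simp) x)]
  simp

theorem HasH1Gradient.const {D : Set Plane} (hD : Bornology.IsBounded D) (c : ℝ) :
    HasH1Gradient D (fun _ => c) (fun _ => 0) where
  memLp := continuous_const.memLp_restrict hD 2
  memLp_gradient := continuous_const.memLp_restrict hD 2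
  weak_gradient φ hφ := by
    have h1 : ∫ x in D, ∇ φ x = 0 := by
      rw [setIntegral_eq_integral_of_forall_compl_eq_zero fun x hx =>
        gradient_eq_zero_of_notMem_tsupport fun h => hx (hφ.2.2 h)]
      exact hφ.2.1.integral_gradient_eq_zero hφ.1
    simp [integral_smul, h1]

/-- A test function of `D'` is one of `D`, and the integrands vanish outside `D'`, so both integrals
equal those over the plane. -/
theorem HasH1Gradient.mono {D D' : Set Plane} (hsub : D' ⊆ D)
    {u : Plane → ℝ} {G : Plane → Plane} (h : HasH1Gradient D u G) : HasH1Gradient D' u G where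
  memLp := h.memLp.mono_measure (Measure.restrict_mono hsub le_rfl)
  memLp_gradient := h.memLp_gradient.mono_measure (Measure.restrict_mono hsub le_rfl)
  weak_gradient φ hφ := by
    have h1 := h.weak_gradient φ ⟨hφ.1, hφ.2.1, hφ.2.2.trans hsub⟩
    have hout : ∀ x ∉ D', x ∉ tsupport φ := fun x hx h => hx (hφ.2.2 h)
    have e1 : ∀ S, D' ⊆ S → ∫ x in S, u x • ∇ φ x = ∫ x, u x • ∇ φ x := fun S hS =>
      setIntegral_eq_integral_of_forall_compl_eq_zero fun x hx => by
        rw [gradient_eq_zero_of_notMem_tsupport (hout x fun h => hx (hS h)), smul_zero]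
    have e2 : ∀ S, D' ⊆ S → ∫ x in S, φ x • G x = ∫ x, φ x • G x := fun S hS =>
      setIntegral_eq_integral_of_forall_compl_eq_zero fun x hx => by
        rw [image_eq_zero_of_notMem_tsupport (hout x fun h => hx (hS h)), zero_smul]
    rw [e1 D' le_rfl, e2 D' le_rfl, ← e1 D hsub, ← e2 D hsub]
    exact h1

theorem HasWeakDivergence.mono {D D' : Set Plane} (hsub : D' ⊆ D)
    {w : Plane → Plane} {g : Plane → ℝ} (h : HasWeakDivergence D w g) :
    HasWeakDivergence D' w g where
  memLp := h.memLp.mono_measure (Measure.restrict_mono hsub le_rfl)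
  memLp_div := h.memLp_div.mono_measure (Measure.restrict_mono hsub le_rfl)
  weak_div φ hφ := by
    have h1 := h.weak_div φ ⟨hφ.1, hφ.2.1, hφ.2.2.trans hsub⟩
    have hout : ∀ x ∉ D', x ∉ tsupport φ := fun x hx h => hx (hφ.2.2 h)
    have e1 : ∀ S, D' ⊆ S → ∫ x in S, inner ℝ (w x) (∇ φ x) = ∫ x, inner ℝ (w x) (∇ φ x) :=
      fun S hS => setIntegral_eq_integral_of_forall_compl_eq_zero fun x hx => by
        rw [gradient_eq_zero_of_notMem_tsupport (hout x fun h => hx (hS h)), inner_zero_right]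
    have e2 : ∀ S, D' ⊆ S → ∫ x in S, g x * φ x = ∫ x, g x * φ x := fun S hS =>
      setIntegral_eq_integral_of_forall_compl_eq_zero fun x hx => by
        rw [image_eq_zero_of_notMem_tsupport (hout x fun h => hx (hS h)), mul_zero]
    rw [e1 D' le_rfl, e2 D' le_rfl, ← e1 D hsub, ← e2 D hsub]
    exact h1

/-- The weak gradient is closed under convergence in `L²`. -/
theorem HasH1Gradient.of_tendsto {ι : Type*} {l : Filter ι} [l.NeBot] {D : Set Plane}
    (hD : Bornology.IsBounded D) {u : ι → Plane → ℝ} {G : ι → Plane → Plane} {w : Plane → ℝ}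
    {Gw : Plane → Plane} (h : ∀ᶠ i in l, HasH1Gradient D (u i) (G i))
    (hw : MemLp w 2 (volume.restrict D)) (hGw : MemLp Gw 2 (volume.restrict D))
    (hu : Tendsto (fun i => eLpNorm (fun x => u i x - w x) 2 (volume.restrict D)) l (𝓝 0))
    (hG : Tendsto (fun i => eLpNorm (fun x => G i x - Gw x) 2 (volume.restrict D)) l (𝓝 0)) :
    HasH1Gradient D w Gw where
  memLp := hw
  memLp_gradient := hGw
  weak_gradient φ hφ := by
    have hm := hφ.1.continuous.memLp_restrict hD 2
    have hmG := hφ.1.continuous_gradient.memLp_restrict hD 2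
    have h1 := tendsto_integral_bilin (ContinuousLinearMap.lsmul ℝ ℝ : ℝ →L[ℝ] Plane →L[ℝ] Plane)
      (h.mono fun i hi => hi.memLp) hw hmG hu
    have h2 := (tendsto_integral_bilin
      (ContinuousLinearMap.lsmul ℝ ℝ : ℝ →L[ℝ] Plane →L[ℝ] Plane).flip
      (h.mono fun i hi => hi.memLp_gradient) hGw hm hG).neg
    refine tendsto_nhds_unique h1 (h2.congr' (h.mono fun i hi => ?_))
    simpa using (hi.weak_gradient φ hφ).symm

theorem normalTrace_tendsto {ι : Type*} {l : Filter ι} {D : Set Plane}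
    (hD : Bornology.IsBounded D) {w : ι → Plane → Plane} {g : ι → Plane → ℝ} {w₀ : Plane → Plane}
    {g₀ : Plane → ℝ} (hw : ∀ᶠ i in l, MemLp (w i) 2 (volume.restrict D))
    (hg : ∀ᶠ i in l, MemLp (g i) 2 (volume.restrict D)) (hw₀ : MemLp w₀ 2 (volume.restrict D))
    (hg₀ : MemLp g₀ 2 (volume.restrict D))
    (hwlim : Tendsto (fun i => eLpNorm (fun x => w i x - w₀ x) 2 (volume.restrict D)) l (𝓝 0))
    (hglim : Tendsto (fun i => eLpNorm (fun x => g i x - g₀ x) 2 (volume.restrict D)) l (𝓝 0))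
    {φ : Plane → ℝ} (hφ : ContDiff ℝ ∞ φ) :
    Tendsto (fun i => normalTrace D (w i) (g i) φ) l (𝓝 (normalTrace D w₀ g₀ φ)) := by
  have hm := hφ.continuous.memLp_restrict hD 2
  have hmG := hφ.continuous_gradient.memLp_restrict hD 2
  have h1 := tendsto_integral_bilin (innerSL ℝ : Plane →L[ℝ] Plane →L[ℝ] ℝ) hw hw₀ hmG hwlim
  have h2 := tendsto_integral_bilin (ContinuousLinearMap.mul ℝ ℝ) hg hg₀ hm hglim
  have h3 : normalTrace D w₀ g₀ φ = (∫ x in D, innerSL ℝ (w₀ x) (∇ φ x))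
      + ∫ x in D, ContinuousLinearMap.mul ℝ ℝ (g₀ x) (φ x) :=
    integral_add (integrable_bilin (innerSL ℝ) hw₀ hmG)
      (integrable_bilin (ContinuousLinearMap.mul ℝ ℝ) hg₀ hm)
  rw [h3]
  refine (h1.add h2).congr' ?_
  filter_upwards [hw, hg] with i hi hi'
  exact (integral_add (integrable_bilin (innerSL ℝ) hi hmG)
      (integrable_bilin (ContinuousLinearMap.mul ℝ ℝ) hi' hm)).symm

/-! ### The cell, its two parts and the Darcy flux -/

namespace MFProblem

variable (P : MFProblem)

theorem isOpen_Km : IsOpen P.Km := P.isOpen_K.sdiff isClosed_closure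

theorem Km_subset : P.Km ⊆ P.K := sdiff_subset

theorem disjoint_Km_Kf : Disjoint P.Km P.Kf :=
  disjoint_left.2 fun _ hx hx' => hx.2 (subset_closure hx')

theorem K_nonempty : P.K.Nonempty := P.Kf_nonempty.mono P.Kf_subset

theorem isBounded_Km : Bornology.IsBounded P.Km := P.isBounded_K.subset P.Km_subset

theorem isBounded_Kf : Bornology.IsBounded P.Kf := P.isBounded_K.subset P.Kf_subset

instance : IsFiniteMeasure (volume.restrict P.K) := ⟨by simpa using P.isBounded_K.measure_lt_top⟩

instance : IsFiniteMeasure (volume.restrict P.Km) := ⟨by simpa using P.isBounded_Km.measure_lt_top⟩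

instance : IsFiniteMeasure (volume.restrict P.Kf) := ⟨by simpa using P.isBounded_Kf.measure_lt_top⟩

theorem volume_real_Km_pos : 0 < volume.real P.Km :=
  ENNReal.toReal_pos (P.isOpen_Km.measure_pos volume P.Km_nonempty).ne'
    P.isBounded_Km.measure_lt_top.ne

theorem volume_real_Kf_pos : 0 < volume.real P.Kf :=
  ENNReal.toReal_pos (P.isOpen_Kf.measure_pos volume P.Kf_nonempty).ne'
    P.isBounded_Kf.measure_lt_top.ne

theorem volume_real_K_pos : 0 < volume.real P.K :=
  ENNReal.toReal_pos (P.isOpen_K.measure_pos volume P.K_nonempty).ne'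
    P.isBounded_K.measure_lt_top.ne

theorem mem_Km_or_Kf_or_interface {x : Plane} (hx : x ∈ P.K) :
    x ∈ P.Km ∨ x ∈ P.Kf ∨ x ∈ P.interface := by
  by_cases h : x ∈ closure P.Kf
  · by_cases h' : x ∈ P.Kf
    · exact Or.inr (Or.inl h')
    · exact Or.inr (Or.inr ⟨⟨h, by rwa [P.isOpen_Kf.interior_eq]⟩, hx⟩)
  · exact Or.inl ⟨hx, h⟩

/-- The two parts miss only the interface, which is null; all splittings of integrals and norms over
the cell come from this. -/
theorem restrict_K : volume.restrict P.K = volume.restrict P.Km + volume.restrict P.Kf := by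
  rw [← Measure.restrict_union P.disjoint_Km_Kf P.isOpen_Kf.measurableSet]
  refine Measure.restrict_congr_set (ae_eq_set.2 ⟨?_, ?_⟩)
  · refine measure_mono_null (fun x hx => ?_) P.interface_null
    rcases P.mem_Km_or_Kf_or_interface hx.1 with h | h | h
    · exact absurd (Or.inl h) hx.2
    · exact absurd (Or.inr h) hx.2
    · exact h
  · rw [sdiff_eq_empty.2 (union_subset P.Km_subset P.Kf_subset), measure_empty]

theorem ae_K_iff {p : Plane → Prop} : (∀ᵐ x ∂volume.restrict P.K, p x) ↔
    (∀ᵐ x ∂volume.restrict P.Km, p x) ∧ ∀ᵐ x ∂volume.restrict P.Kf, p x := by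
  rw [restrict_K, ae_add_measure_iff]

theorem volume_real_K : volume.real P.K = volume.real P.Km + volume.real P.Kf := by
  have h := congrArg (fun μ => (μ univ).toReal) P.restrict_K
  simp only [Measure.restrict_apply_univ, Measure.add_apply] at h
  rw [ENNReal.toReal_add P.isBounded_Km.measure_lt_top.ne P.isBounded_Kf.measure_lt_top.ne] at h
  exact h

section

variable {E : Type*} [NormedAddCommGroup E] {f : Plane → E}

theorem eLpNorm_K_le (f : Plane → E) : eLpNorm f 2 (volume.restrict P.K)
    ≤ eLpNorm f 2 (volume.restrict P.Km) + eLpNorm f 2 (volume.restrict P.Kf) := by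
  rw [← ENNReal.pow_le_pow_left_iff two_ne_zero, eLpNorm_two_pow, restrict_K,
    lintegral_add_measure, ← eLpNorm_two_pow, ← eLpNorm_two_pow, add_sq]
  gcongr
  exact le_self_add

theorem memLp_K (hm : MemLp f 2 (volume.restrict P.Km)) (hf : MemLp f 2 (volume.restrict P.Kf)) :
    MemLp f 2 (volume.restrict P.K) := by
  refine ⟨?_, (P.eLpNorm_K_le f).trans_lt (ENNReal.add_lt_top.2 ⟨hm.2, hf.2⟩)⟩
  rw [restrict_K]
  exact aestronglyMeasurable_add_measure_iff.2 ⟨hm.1, hf.1⟩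

theorem memLp_Km {p : ℝ≥0∞} (h : MemLp f p (volume.restrict P.K)) :
    MemLp f p (volume.restrict P.Km) :=
  h.mono_measure (Measure.restrict_mono P.Km_subset le_rfl)

theorem memLp_Kf {p : ℝ≥0∞} (h : MemLp f p (volume.restrict P.K)) :
    MemLp f p (volume.restrict P.Kf) :=
  h.mono_measure (Measure.restrict_mono P.Kf_subset le_rfl)

theorem setIntegral_K [NormedSpace ℝ E] (hm : IntegrableOn f P.Km) (hf : IntegrableOn f P.Kf) :
    ∫ x in P.K, f x = (∫ x in P.Km, f x) + ∫ x in P.Kf, f x := by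
  rw [restrict_K]
  exact integral_add_measure hm hf

end

theorem normalTrace_K {w : Plane → Plane} {g φ : Plane → ℝ} (hw : MemLp w 2 (volume.restrict P.K))
    (hg : MemLp g 2 (volume.restrict P.K)) (hφ : ContDiff ℝ ∞ φ) :
    normalTrace P.K w g φ = normalTrace P.Km w g φ + normalTrace P.Kf w g φ :=
  P.setIntegral_K (integrable_normalTrace P.isBounded_Km (P.memLp_Km hw) (P.memLp_Km hg) hφ)
    (integrable_normalTrace P.isBounded_Kf (P.memLp_Kf hw) (P.memLp_Kf hg) hφ)

theorem darcyFlux_sub (G G' : Plane → Plane) :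
    P.darcyFlux (fun x => G x - G' x) = fun x => P.darcyFlux G x - P.darcyFlux G' x := by
  ext1 x
  simp only [darcyFlux, map_sub, smul_sub]
  abel

theorem exists_norm_darcyFlux_le :
    ∃ C : NNReal, ∀ (G : Plane → Plane), ∀ x ∈ P.K, ‖P.darcyFlux G x‖ ≤ C * ‖G x‖ := by
  obtain ⟨β, hβ⟩ := P.perm_bounded
  refine ⟨⟨P.visc⁻¹ * |β|, mul_nonneg (inv_nonneg.2 P.visc_pos.le) (abs_nonneg _)⟩, fun G x hx => ?_⟩
  rw [darcyFlux, norm_neg, norm_smul, Real.norm_of_nonneg (inv_nonneg.2 P.visc_pos.le)]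
  change _ ≤ P.visc⁻¹ * |β| * ‖G x‖
  rw [mul_assoc]
  have := P.visc_pos
  gcongr
  refine ((P.perm x).le_opNorm _).trans ?_
  gcongr
  exact (hβ x hx).trans (le_abs_self β)

theorem exists_eLpNorm_darcyFlux_le :
    ∃ C : NNReal, ∀ (G : Plane → Plane), eLpNorm (P.darcyFlux G) 2 (volume.restrict P.K)
      ≤ C * eLpNorm G 2 (volume.restrict P.K) := by
  obtain ⟨C, hC⟩ := P.exists_norm_darcyFlux_le
  refine ⟨C, fun G => ?_⟩
  have := eLpNorm_le_mul_eLpNorm_of_ae_le_mul (μ := volume.restrict P.K) (c := C)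
    ((ae_restrict_mem P.isOpen_K.measurableSet).mono (hC G)) 2
  simpa using this

/-- Measurability of the tensor is assumed for each fixed vector only, so `G x` is expanded in the
standard basis. -/
theorem aestronglyMeasurable_darcyFlux {μ : Measure Plane} {G : Plane → Plane}
    (hG : AEStronglyMeasurable G μ) : AEStronglyMeasurable (P.darcyFlux G) μ := by
  have h : P.darcyFlux G = fun x => -(P.visc⁻¹ • ∑ i : Fin 2, (G x) i •
      P.perm x (EuclideanSpace.basisFun (Fin 2) ℝ i)) := by
    ext1 x
    simp only [darcyFlux]
    conv_lhs => rw [← (EuclideanSpace.basisFun (Fin 2) ℝ).sum_repr (G x)]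
    simp
  rw [h]
  have hi : ∀ i : Fin 2, AEStronglyMeasurable
      (fun x => (G x) i • P.perm x (EuclideanSpace.basisFun (Fin 2) ℝ i)) μ := fun i =>
    ((EuclideanSpace.proj (𝕜 := ℝ) i).continuous.comp_aestronglyMeasurable hG).smul
      (P.perm_measurable _).aestronglyMeasurable
  exact ((Finset.aestronglyMeasurable_fun_sum Finset.univ fun i _ => hi i).const_smul P.visc⁻¹).neg

theorem memLp_darcyFlux {G : Plane → Plane} (hG : MemLp G 2 (volume.restrict P.K)) :
    MemLp (P.darcyFlux G) 2 (volume.restrict P.K) := by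
  obtain ⟨C, hC⟩ := P.exists_eLpNorm_darcyFlux_le
  exact ⟨P.aestronglyMeasurable_darcyFlux hG.1,
    (hC G).trans_lt (ENNReal.mul_lt_top (by simp) hG.2)⟩

/-! ### Stability and gluing of the boundary conditions -/

/-- Stability of the pure Neumann problem. -/
theorem exists_stability : ∃ C : NNReal, ∀ (u g : Plane → ℝ) (G : Plane → Plane),
    HasH1Gradient P.K u G → MemLp g 2 (volume.restrict P.K) →
    (∀ φ : Plane → ℝ, ContDiff ℝ ∞ φ → normalTrace P.K (P.darcyFlux G) g φ = 0) →
      eLpNorm G 2 (volume.restrict P.K) ≤ C * eLpNorm g 2 (volume.restrict P.K) ∧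
      eLpNorm (P.fluctuation u) 2 (volume.restrict P.K)
        ≤ C * eLpNorm g 2 (volume.restrict P.K) := by
  obtain ⟨α, hα, hell⟩ := P.perm_elliptic
  obtain ⟨d, hd⟩ := Metric.isBounded_iff.1 P.isBounded_K
  have hd' : ∀ x ∈ P.K, ∀ y ∈ P.K, ‖x - y‖ ≤ |d| := fun x hx y hy => by
    rw [← dist_eq_norm]; exact (hd hx hy).trans (le_abs_self d)
  set a := P.visc⁻¹ * α with ha
  have ha0 : 0 < a := mul_pos (inv_pos.2 P.visc_pos) hα
  set D := 2 * |d| with hD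
  have hD0 : 0 ≤ D := by positivity
  -- `D / a` controls the gradient, and the Poincaré factor `D` adds `D * (D / a)` for the
  -- fluctuation; the sum serves both.
  refine ⟨(D / a).toNNReal + (D * (D / a)).toNNReal, fun u g G h hg h0 => ?_⟩
  have hpoin : eLpNorm (P.fluctuation u) 2 (volume.restrict P.K)
      ≤ ENNReal.ofReal D * eLpNorm G 2 (volume.restrict P.K) :=
    h.poincare P.isOpen_K P.isBounded_K P.convex_K P.K_nonempty (abs_nonneg d) hd'
  have hflux := P.memLp_darcyFlux h.memLp_gradient
  have hweak := h.weak_form P.isOpen_K P.isBounded_K P.convex_K P.K_nonempty hflux hg h0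
  -- The compatibility condition of the Neumann problem, from the test function `1`. It allows `u`
  -- to be replaced by its fluctuation in the source term.
  have hmean : ∫ x in P.K, g x = 0 := by
    have := h0 (fun _ => 1) contDiff_const
    simpa [normalTrace] using this
  set m := ⨍ y in P.K, u y with hm
  have hfl : MemLp (P.fluctuation u) 2 (volume.restrict P.K) := h.memLp.sub (memLp_const m)
  have hgf : ∫ x in P.K, g x * u x = ∫ x in P.K, g x * P.fluctuation u x := by
    have : ∀ x, g x * P.fluctuation u x = g x * u x - g x * m := fun x => by
      rw [fluctuation]; ring
    have hi : Integrable (fun x => g x * u x) (volume.restrict P.K) :=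
      integrable_bilin (ContinuousLinearMap.mul ℝ ℝ) hg h.memLp
    simp_rw [this]
    rw [integral_sub hi (hg.integrable_two.mul_const m), integral_mul_const, hmean, zero_mul, sub_zero]
  set N := (eLpNorm G 2 (volume.restrict P.K)).toReal with hN
  set M := (eLpNorm g 2 (volume.restrict P.K)).toReal with hM
  have hNe : eLpNorm G 2 (volume.restrict P.K) = ENNReal.ofReal N :=
    (ENNReal.ofReal_toReal h.memLp_gradient.2.ne).symm
  have hMe : eLpNorm g 2 (volume.restrict P.K) = ENNReal.ofReal M :=
    (ENNReal.ofReal_toReal hg.2.ne).symm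
  have hN0 : 0 ≤ N := ENNReal.toReal_nonneg
  have hM0 : 0 ≤ M := ENNReal.toReal_nonneg
  have hsqint : Integrable (fun x => ‖G x‖ ^ 2) (volume.restrict P.K) :=
    (memLp_two_iff_integrable_sq_norm h.memLp_gradient.1).1 h.memLp_gradient
  have hsq : ∫ x in P.K, ‖G x‖ ^ 2 = N ^ 2 := by
    rw [integral_eq_lintegral_of_nonneg_ae (.of_forall fun x => by positivity) hsqint.1, hN,
      ← ENNReal.toReal_pow, eLpNorm_two_pow]
    congr 1
    refine lintegral_congr fun x => ?_
    rw [ENNReal.ofReal_pow (norm_nonneg _), ofReal_norm]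
  have hlow : a * N ^ 2 ≤ -∫ x in P.K, inner ℝ (P.darcyFlux G x) (G x) := by
    rw [← hsq, ← integral_const_mul, ← integral_neg]
    refine setIntegral_mono_on (hsqint.const_mul a)
      (integrable_bilin (innerSL ℝ) hflux h.memLp_gradient).neg P.isOpen_K.measurableSet
      fun x hx => ?_
    rw [darcyFlux, inner_neg_left, neg_neg, real_inner_smul_left, ha, mul_assoc]
    have := P.visc_pos
    gcongr
    exact hell x hx (G x)
  have hup : |∫ x in P.K, g x * P.fluctuation u x| ≤ M * (D * N) := by
    have h1 := enorm_integral_bilin_le (ContinuousLinearMap.mul ℝ ℝ) hg.1 hfl.1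
    have h2 : ‖ContinuousLinearMap.mul ℝ ℝ‖ₑ ≤ 1 := by
      rw [← ofReal_norm, ← ENNReal.ofReal_one]
      exact ENNReal.ofReal_le_ofReal (ContinuousLinearMap.opNorm_mul_le ℝ ℝ)
    have h3 : ‖∫ x in P.K, g x * P.fluctuation u x‖ₑ
        ≤ ENNReal.ofReal M * (ENNReal.ofReal D * ENNReal.ofReal N) := by
      refine h1.trans ?_
      rw [← hMe, ← hNe]
      calc _ ≤ 1 * eLpNorm g 2 (volume.restrict P.K)
            * (ENNReal.ofReal D * eLpNorm G 2 (volume.restrict P.K)) := by gcongr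
        _ = _ := by rw [one_mul]
    rw [← ENNReal.ofReal_mul hD0, ← ENNReal.ofReal_mul hM0, ← ofReal_norm,
      ENNReal.ofReal_le_ofReal_iff (by positivity)] at h3
    exact h3
  -- The energy identity gives `a N² ≤ M D N`; cancel `N` unless it is zero.
  have hNM : N ≤ D / a * M := by
    have h1 : a * N ^ 2 ≤ M * (D * N) := by
      refine hlow.trans (le_trans (le_of_eq ?_) ((le_abs_self _).trans hup))
      rw [← hgf]; linarith
    rcases hN0.eq_or_lt with h2 | h2
    · rw [← h2]; positivity
    · have h3 : a * N ≤ M * D := le_of_mul_le_mul_right (by linarith) h2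
      rw [div_mul_eq_mul_div, le_div_iff₀ ha0]
      linarith
  have hGle : eLpNorm G 2 (volume.restrict P.K) ≤ ENNReal.ofReal (D / a)
      * eLpNorm g 2 (volume.restrict P.K) := by
    rw [hNe, hMe, ← ENNReal.ofReal_mul (by positivity)]
    exact ENNReal.ofReal_le_ofReal hNM
  constructor
  · refine hGle.trans ?_
    gcongr
    simp [ENNReal.ofReal]
  · refine hpoin.trans ?_
    calc _ ≤ ENNReal.ofReal D * (ENNReal.ofReal (D / a) * eLpNorm g 2 (volume.restrict P.K)) := by
          gcongr
      _ ≤ _ := by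
          rw [← mul_assoc, ← ENNReal.ofReal_mul hD0]
          gcongr
          simp [ENNReal.ofReal]

/-- The conditions on `Γ_m`, `Γ_f` and `Γ_I` combine to the absence of flow through the boundary of
the cell. -/
theorem normalTrace_eq_zero {w : Plane → Plane} {g : Plane → ℝ}
    (hw : MemLp w 2 (volume.restrict P.K)) (hg : MemLp g 2 (volume.restrict P.K))
    (hout : ∀ φ : Plane → ℝ, ContDiff ℝ ∞ φ → Disjoint (tsupport φ) (closure P.interface) →
      normalTrace P.K w g φ = 0)
    (hin : ∀ φ, IsTestFunction P.K φ → normalTrace P.K w g φ = 0)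
    {φ : Plane → ℝ} (hφ : ContDiff ℝ ∞ φ) : normalTrace P.K w g φ = 0 := by
  refine normalTrace_eq_zero_of_finite P.isBounded_K hw hg P.interface_ends (fun φ hφ hd => ?_) hφ
  -- Since `φ` avoids the ends of the interface, `S` is a compact subset of `K`. A cutoff `χ` equal
  -- to `1` near `S` and supported in `K` makes `χ φ` a test function of `K`, while `(1 - χ) φ`
  -- vanishes near the closed interface.
  set S := tsupport φ ∩ closure P.interface with hS
  have hIK : P.interface ⊆ P.K := inter_subset_right
  have hScl : IsClosed S := (isClosed_tsupport φ).inter isClosed_closure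
  have hSc : IsCompact S :=
    ((P.isBounded_K.subset hIK).isCompact_closure).inter_left (isClosed_tsupport φ)
  have hSK : S ⊆ P.K := fun x hx => by
    by_contra h
    refine disjoint_left.1 hd hx.1 ⟨hx.2, closure_mono hIK hx.2, ?_⟩
    rwa [P.isOpen_K.interior_eq]
  obtain ⟨Q, hQ, hSQ, hQK⟩ := exists_compact_between hSc P.isOpen_K hSK
  obtain ⟨χ, hχ1, hχ0, -⟩ := exists_contMDiffMap_one_nhds_of_subset_interior (n := (⊤ : ℕ∞))
    (modelWithCornersSelf ℝ Plane) hScl hSQ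
  have hχ : ContDiff ℝ ∞ χ := χ.contMDiff.contDiff
  have hsupp : tsupport χ ⊆ Q := closure_minimal
    (fun x (hx : _ ≠ _) => by_contra fun h => hx (hχ0 x h)) hQ.isClosed
  have hsm1 : ContDiff ℝ ∞ fun x => χ x * φ x := hχ.mul hφ
  have hsm2 : ContDiff ℝ ∞ fun x => (1 - χ x) * φ x := (contDiff_const.sub hχ).mul hφ
  have h1 : normalTrace P.K w g (fun x => χ x * φ x) = 0 := by
    refine hin _ ⟨hsm1, ?_, ?_⟩
    · exact HasCompactSupport.mul_right (HasCompactSupport.of_support_subset_isCompact hQ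
        ((subset_tsupport _).trans hsupp))
    · exact (tsupport_mul_subset_left.trans hsupp).trans hQK
  have h2 : normalTrace P.K w g (fun x => (1 - χ x) * φ x) = 0 := by
    refine hout _ hsm2 (disjoint_left.2 fun x hx hx' => ?_)
    have hxS : x ∈ S := ⟨tsupport_mul_subset_right hx, hx'⟩
    refine notMem_tsupport_iff_eventuallyEq.2 ?_ hx
    filter_upwards [hχ1.filter_mono (nhds_le_nhdsSet hxS)] with y hy
    simp [hy]
  have h3 := normalTrace_add P.isBounded_K hw hg hsm1 hsm2
  rw [h1, h2, add_zero] at h3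
  rw [← h3]
  congr 1
  ext x
  ring

end MFProblem

/-! ### Time derivatives and limits at large times -/

theorem HasL2TimeDeriv.hasDerivAt_integral {D : Set Plane} [IsFiniteMeasure (volume.restrict D)]
    {p : ℝ → Plane → ℝ} {s : Plane → ℝ} {t : ℝ} (h : HasL2TimeDeriv D p s t)
    (hp : ∀ᶠ τ in 𝓝 t, MemLp (p τ) 2 (volume.restrict D)) :
    HasDerivAt (fun τ => ∫ x in D, p τ x) (∫ x in D, s x) t := by
  rw [hasDerivAt_iff_tendsto_slope_zero]
  have hpt := hp.self_of_nhds
  have h0 : Tendsto (fun h : ℝ => t + h) (𝓝[≠] 0) (𝓝 t) := by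
    have : Tendsto (fun h : ℝ => t + h) (𝓝 0) (𝓝 (t + 0)) := by
      exact (continuous_const.add continuous_id).tendsto 0
    rw [add_zero] at this
    exact this.mono_left nhdsWithin_le_nhds
  have hev := h0.eventually hp
  have hlim := tendsto_integral_of_L2 (hev.mono fun τ hτ => (hτ.sub hpt).const_mul τ⁻¹) h.1 h.2
  refine hlim.congr' (hev.mono fun τ hτ => ?_)
  change _ = τ⁻¹ * _
  rw [← integral_sub hτ.integrable_two hpt.integrable_two, ← integral_const_mul]
  rfl

/-- If a function converges at infinity and its derivative does, then the limit of the derivative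
is zero. -/
theorem eq_zero_of_tendsto_of_tendsto_deriv {f f' : ℝ → ℝ} {T a c : ℝ}
    (hf : ∀ t, T < t → HasDerivAt f (f' t) t) (ha : Tendsto f atTop (𝓝 a))
    (hc : Tendsto f' atTop (𝓝 c)) : c = 0 := by
  -- Mean value theorem on `[t, t + 1]`: the increments tend to zero, and the intermediate points
  -- tend to infinity.
  have hmv : ∀ t, T < t → ∃ ξ, t < ξ ∧ f' ξ = f (t + 1) - f t := by
    intro t ht
    obtain ⟨ξ, hξ, h⟩ := exists_hasDerivAt_eq_slope f f' (lt_add_one t)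
      (fun x hx => (hf x (ht.trans_le hx.1)).continuousAt.continuousWithinAt)
      (fun x hx => hf x (ht.trans hx.1))
    exact ⟨ξ, hξ.1, by simpa using h⟩
  choose! ξ hξ hξ' using hmv
  have hξlim : Tendsto ξ atTop atTop :=
    tendsto_atTop_mono' _ ((eventually_gt_atTop T).mono fun t ht => (hξ t ht).le) tendsto_id
  have h1 : Tendsto (fun t => f (t + 1) - f t) atTop (𝓝 (a - a)) :=
    (ha.comp (tendsto_atTop_add_const_right _ 1 tendsto_id)).sub ha
  rw [sub_self] at h1
  refine tendsto_nhds_unique ((hc.comp hξlim).congr' ?_) h1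
  exact (eventually_gt_atTop T).mono fun t ht => hξ' t ht

theorem exists_tendsto_of_eLpNorm_sub_le {α E : Type*} [MeasurableSpace α] {μ : Measure α}
    [NormedAddCommGroup E] [CompleteSpace E] {f : ℝ → α → E} {b : ℝ → ℝ≥0∞} {T : ℝ}
    (hf : ∀ t, T < t → MemLp (f t) 2 μ)
    (h : ∀ t, T < t → ∀ t', T < t' → eLpNorm (fun x => f t x - f t' x) 2 μ ≤ b t + b t')
    (hb : Tendsto b atTop (𝓝 0)) :
    ∃ g : α → E, MemLp g 2 μ ∧ Tendsto (fun t => eLpNorm (fun x => f t x - g x) 2 μ) atTop (𝓝 0) := by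
  classical
  set F : ℝ → Lp E 2 μ := fun t => if ht : T < t then (hf t ht).toLp (f t) else 0 with hF
  have hFt : ∀ t (ht : T < t), F t = (hf t ht).toLp (f t) := fun t ht => dif_pos ht
  have hcauchy : CauchySeq F := by
    rw [EMetric.cauchySeq_iff]
    intro ε hε
    have hε2 : 0 < ε / 2 := ENNReal.half_pos hε.ne'
    obtain ⟨N, hN⟩ := eventually_atTop.1
      ((hb.eventually (gt_mem_nhds hε2)).and (eventually_gt_atTop T))
    refine ⟨N, fun m hm n hn => ?_⟩
    rw [hFt m (hN m hm).2, hFt n (hN n hn).2, Lp.edist_toLp_toLp]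
    calc _ ≤ b m + b n := h m (hN m hm).2 n (hN n hn).2
      _ < ε / 2 + ε / 2 := ENNReal.add_lt_add (hN m hm).1 (hN n hn).1
      _ = ε := ENNReal.add_halves ε
  obtain ⟨g, hg⟩ := cauchySeq_tendsto_of_complete hcauchy
  refine ⟨g, Lp.memLp g, ?_⟩
  rw [tendsto_iff_edist_tendsto_0] at hg
  refine hg.congr' ((eventually_gt_atTop T).mono fun t ht => ?_)
  rw [hFt t ht, Lp.edist_def]
  refine eLpNorm_congr_ae ?_
  filter_upwards [(hf t ht).coeFn_toLp] with x hx
  simp [hx]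

/-! ### Fluctuations and uniqueness of the stationary solution -/

namespace MFProblem

variable (P : MFProblem)

theorem integral_fluctuation {u : Plane → ℝ} (hu : Integrable u (volume.restrict P.K)) :
    ∫ x in P.K, P.fluctuation u x = 0 := by
  have hV := P.volume_real_K_pos.ne'
  simp only [fluctuation]
  rw [integral_sub hu (integrable_const _), setAverage_eq, integral_const]
  simp [hV]

theorem setIntegral_fluctuation {D : Set Plane} (hD : D ⊆ P.K) {u : Plane → ℝ}
    (hu : Integrable u (volume.restrict P.K)) :
    ∫ x in D, P.fluctuation u x = (∫ x in D, u x) - volume.real D * ⨍ x in P.K, u x := by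
  have : IsFiniteMeasure (volume.restrict D) :=
    ⟨by simpa using (P.isBounded_K.subset hD).measure_lt_top⟩
  simp only [fluctuation]
  rw [integral_sub (hu.mono_measure (Measure.restrict_mono hD le_rfl)) (integrable_const _),
    integral_const]
  simp

theorem fluctuation_sub {u v : Plane → ℝ} (hu : Integrable u (volume.restrict P.K))
    (hv : Integrable v (volume.restrict P.K)) :
    P.fluctuation (fun x => u x - v x) = fun x => P.fluctuation u x - P.fluctuation v x := by
  ext1 x
  simp only [fluctuation, setAverage_eq]
  rw [integral_sub hu hv, smul_sub]
  ring

theorem fluctuation_of_average_eq_zero {u : Plane → ℝ} (h : ⨍ x in P.K, u x = 0) :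
    P.fluctuation u = u := by
  ext1 x
  rw [fluctuation, h, sub_zero]

theorem average_fluctuation {u : Plane → ℝ} (hu : Integrable u (volume.restrict P.K)) :
    ⨍ x in P.K, P.fluctuation u x = 0 := by
  rw [setAverage_eq, P.integral_fluctuation hu, smul_zero]

theorem hasH1Gradient_fluctuation {u : Plane → ℝ} {G : Plane → Plane}
    (h : HasH1Gradient P.K u G) : HasH1Gradient P.K (P.fluctuation u) G :=
  (h.sub P.isBounded_K (HasH1Gradient.const P.isBounded_K (⨍ x in P.K, u x))).congr_ae
    .rfl (.of_forall fun _ => sub_zero _)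

/-- The Neumann problem depends in `H¹` continuously on its source. -/
theorem exists_stability_sub : ∃ C : NNReal, ∀ (u u' g g' : Plane → ℝ) (G G' : Plane → Plane),
    HasH1Gradient P.K u G → HasH1Gradient P.K u' G' →
    MemLp g 2 (volume.restrict P.K) → MemLp g' 2 (volume.restrict P.K) →
    (∀ φ : Plane → ℝ, ContDiff ℝ ∞ φ → normalTrace P.K (P.darcyFlux G) g φ = 0) →
    (∀ φ : Plane → ℝ, ContDiff ℝ ∞ φ → normalTrace P.K (P.darcyFlux G') g' φ = 0) →
      eLpNorm (fun x => G x - G' x) 2 (volume.restrict P.K)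
        ≤ C * eLpNorm (fun x => g x - g' x) 2 (volume.restrict P.K) ∧
      eLpNorm (fun x => P.fluctuation u x - P.fluctuation u' x) 2 (volume.restrict P.K)
        ≤ C * eLpNorm (fun x => g x - g' x) 2 (volume.restrict P.K) := by
  obtain ⟨C, hC⟩ := P.exists_stability
  refine ⟨C, fun u u' g g' G G' h h' hg hg' h0 h0' => ?_⟩
  have := hC _ _ _ (h.sub P.isBounded_K h') (hg.sub hg') fun φ hφ => by
    change normalTrace _ _ (fun x => g x - g' x) _ = 0
    rw [P.darcyFlux_sub, normalTrace_sub P.isBounded_K (P.memLp_darcyFlux h.memLp_gradient) hg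
      (P.memLp_darcyFlux h'.memLp_gradient) hg' hφ, h0 φ hφ, h0' φ hφ, sub_zero]
  rwa [P.fluctuation_sub h.memLp.integrable_two h'.memLp.integrable_two] at this

theorem stationary_unique {qs : ℝ} {u v : Plane → ℝ} (hu : P.IsStationarySolution qs u)
    (hv : P.IsStationarySolution qs v) : u =ᵐ[volume.restrict P.K] v := by
  obtain ⟨⟨G, hG, hGd, hGn⟩, hu0⟩ := hu
  obtain ⟨⟨G', hG', hGd', hGn'⟩, hv0⟩ := hv
  obtain ⟨C, hC⟩ := P.exists_stability_sub
  have h := (hC u v _ _ G G' hG hG' hGd.memLp_div hGd'.memLp_div hGn hGn').2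
  rw [P.fluctuation_of_average_eq_zero hu0, P.fluctuation_of_average_eq_zero hv0] at h
  simp only [sub_self, eLpNorm_zero', mul_zero, nonpos_iff_eq_zero] at h
  exact ((eLpNorm_eq_zero_iff (hG.memLp.1.sub hG'.memLp.1) two_ne_zero).1 h).mono fun x hx => sub_eq_zero.1 hx

/-! ### Reduction of the coupled problem to a Neumann problem -/

/-- The divergence of the flux that the flow equations prescribe, for the time derivative `s` of
the pressure. -/
noncomputable def fluxDivergence (s : Plane → ℝ) : Plane → ℝ := fun x =>
  P.Kf.indicator (fun y => P.q - P.cf * P.Φf * s y) x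
    + P.Km.indicator (fun y => -(P.cm * P.Φm * s y)) x

theorem fluxDivergence_of_mem_Km (s : Plane → ℝ) {x : Plane} (hx : x ∈ P.Km) :
    P.fluxDivergence s x = -(P.cm * P.Φm * s x) := by
  simp [fluxDivergence, hx, disjoint_left.1 P.disjoint_Km_Kf hx]

theorem fluxDivergence_of_mem_Kf (s : Plane → ℝ) {x : Plane} (hx : x ∈ P.Kf) :
    P.fluxDivergence s x = P.q - P.cf * P.Φf * s x := by
  simp [fluxDivergence, hx, disjoint_right.1 P.disjoint_Km_Kf hx]

theorem stationarySource_of_mem_Km (qs : ℝ) {x : Plane} (hx : x ∈ P.Km) :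
    P.stationarySource qs x = -(volume.real P.Kf / volume.real P.Km) * qs := by
  simp [stationarySource, hx, disjoint_left.1 P.disjoint_Km_Kf hx]

theorem stationarySource_of_mem_Kf (qs : ℝ) {x : Plane} (hx : x ∈ P.Kf) :
    P.stationarySource qs x = qs := by
  simp [stationarySource, hx, disjoint_right.1 P.disjoint_Km_Kf hx]

theorem memLp_stationarySource (qs : ℝ) :
    MemLp (P.stationarySource qs) 2 (volume.restrict P.K) := by
  have h1 : MemLp (P.Kf.indicator fun _ => qs) 2 (volume.restrict P.K) :=
    (memLp_const qs).indicator P.isOpen_Kf.measurableSet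
  have h2 : MemLp (P.Km.indicator fun _ => -(volume.real P.Kf / volume.real P.Km) * qs) 2
      (volume.restrict P.K) := (memLp_const _).indicator P.isOpen_Km.measurableSet
  exact h1.add h2

variable {P}

/-- The balance says that the sources of matrix and fracture cancel in total, which fixes the
constant matrix source in terms of the fracture source. -/
theorem Balance.matrix_source {am af : ℝ} (h : P.Balance am af) :
    -(volume.real P.Kf / volume.real P.Km) * (P.q - P.cf * P.Φf * af) = -(P.cm * P.Φm * am) := by
  have hV := P.volume_real_Km_pos
  unfold Balance at h
  field_simp
  linarith

/-- The sum of the two pressure traces, for a test function of `K`, is the defect in the weak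
gradient identity on `K`, so its vanishing glues the pressure. The flux conditions glue by
`normalTrace_eq_zero`. -/
theorem HoldsAt.exists_gradient {p s : Plane → ℝ} (h : P.HoldsAt p s) :
    ∃ G, HasH1Gradient P.K p G ∧ MemLp (P.fluxDivergence s) 2 (volume.restrict P.K) ∧
      ∀ φ : Plane → ℝ, ContDiff ℝ ∞ φ →
        normalTrace P.K (P.darcyFlux G) (P.fluxDivergence s) φ = 0 := by
  obtain ⟨G, g, hm, hf, hdm, hem, hdf, hef, hnf, hpt, hnt⟩ := h
  have hH : HasH1Gradient P.K p G := by
    refine ⟨P.memLp_K hm.memLp hf.memLp, P.memLp_K hm.memLp_gradient hf.memLp_gradient,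
      fun φ hφ => ?_⟩
    have hmem := fun D (hD : Bornology.IsBounded D) => hφ.1.continuous.memLp_restrict hD 2
    have hmemG := fun D (hD : Bornology.IsBounded D) => hφ.1.continuous_gradient.memLp_restrict hD 2
    have i1 : ∀ D, Bornology.IsBounded D → HasH1Gradient D p G →
        IntegrableOn (fun x => p x • ∇ φ x) D := fun D hD h =>
      integrable_bilin (ContinuousLinearMap.lsmul ℝ ℝ) h.memLp (hmemG D hD)
    have i2 : ∀ D, Bornology.IsBounded D → HasH1Gradient D p G →
        IntegrableOn (fun x => φ x • G x) D := fun D hD h =>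
      integrable_bilin (ContinuousLinearMap.lsmul ℝ ℝ) (hmem D hD) h.memLp_gradient
    have h1 := hpt φ hφ
    simp only [pressureTrace] at h1
    rw [integral_add (i1 _ P.isBounded_Km hm) (i2 _ P.isBounded_Km hm),
      integral_add (i1 _ P.isBounded_Kf hf) (i2 _ P.isBounded_Kf hf)] at h1
    rw [P.setIntegral_K (i1 _ P.isBounded_Km hm) (i1 _ P.isBounded_Kf hf),
      P.setIntegral_K (i2 _ P.isBounded_Km hm) (i2 _ P.isBounded_Kf hf), eq_neg_iff_add_eq_zero,
      ← h1]
    abel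
  have hg : MemLp g 2 (volume.restrict P.K) := P.memLp_K hdm.memLp_div hdf.memLp_div
  have hw := P.memLp_darcyFlux hH.memLp_gradient
  have hgs : g =ᵐ[volume.restrict P.K] P.fluxDivergence s := by
    refine P.ae_K_iff.2 ⟨?_, ?_⟩
    · filter_upwards [hem, ae_restrict_mem P.isOpen_Km.measurableSet] with x hx hxm
      rw [P.fluxDivergence_of_mem_Km s hxm]
      linarith
    · filter_upwards [hef, ae_restrict_mem P.isOpen_Kf.measurableSet] with x hx hxm
      rw [P.fluxDivergence_of_mem_Kf s hxm]
      linarith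
  refine ⟨G, hH, (memLp_congr_ae hgs).1 hg, fun φ hφ => ?_⟩
  rw [← normalTrace_congr_ae hgs]
  refine P.normalTrace_eq_zero hw hg (fun φ hφ hd => ?_) (fun φ hφ => ?_) hφ
  · rw [P.normalTrace_K hw hg hφ, (hnf φ hφ hd).1, (hnf φ hφ hd).2, add_zero]
  · rw [P.normalTrace_K hw hg hφ.1, hnt φ hφ]

theorem HoldsAt.mass_balance {p s : Plane → ℝ} (h : P.HoldsAt p s)
    (hsf : MemLp s 2 (volume.restrict P.Kf)) :
    (∫ x in P.Km, P.cm * P.Φm * s x) + (∫ x in P.Kf, P.cf * P.Φf * s x) = ∫ _x in P.Kf, P.q := by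
  obtain ⟨G, -, hmem, h0⟩ := h.exists_gradient
  have h1 := h0 (fun _ => 1) contDiff_const
  simp only [normalTrace, gradient_fun_const, inner_zero_right, zero_add, mul_one] at h1
  rw [P.setIntegral_K (P.memLp_Km hmem).integrable_two (P.memLp_Kf hmem).integrable_two,
    setIntegral_congr_fun P.isOpen_Km.measurableSet
      (fun x hx => P.fluxDivergence_of_mem_Km s hx),
    setIntegral_congr_fun P.isOpen_Kf.measurableSet
      (fun x hx => P.fluxDivergence_of_mem_Kf s hx), integral_neg,
    integral_sub (integrable_const _) (hsf.integrable_two.const_mul _)] at h1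
  linarith

theorem isStationarySolution_fluctuation {u : Plane → ℝ} {G : Plane → Plane} {qs : ℝ}
    (h : HasH1Gradient P.K u G) (h0 : ∀ φ : Plane → ℝ, ContDiff ℝ ∞ φ →
      normalTrace P.K (P.darcyFlux G) (P.stationarySource qs) φ = 0) :
    P.IsStationarySolution qs (P.fluctuation u) :=
  ⟨⟨G, P.hasH1Gradient_fluctuation h, hasWeakDivergence_of_normalTrace P.isBounded_K
    (P.memLp_darcyFlux h.memLp_gradient) (P.memLp_stationarySource qs) fun φ hφ => h0 φ hφ.1, h0⟩,
    P.average_fluctuation h.memLp.integrable_two⟩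

end MFProblem

theorem normalTrace_congr {D : Set Plane} (hD : IsOpen D) {w : Plane → Plane}
    {g φ ψ : Plane → ℝ} (h : EqOn φ ψ D) : normalTrace D w g φ = normalTrace D w g ψ := by
  refine setIntegral_congr_fun hD.measurableSet fun x hx => ?_
  have h1 : φ =ᶠ[𝓝 x] ψ := h.eventuallyEq_of_mem (hD.mem_nhds hx)
  simp only [h1.gradient_eq, h hx]

theorem eLpNorm_sub_eq_zero_of_ae_eq {α E : Type*} [MeasurableSpace α] {μ : Measure α}
    [NormedAddCommGroup E] {f g : α → E} (h : f =ᵐ[μ] g) (p : ℝ≥0∞) :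
    eLpNorm (fun x => f x - g x) p μ = 0 := by
  have h0 : (fun x => f x - g x) =ᵐ[μ] 0 := h.mono fun x hx => sub_eq_zero.2 hx
  rw [eLpNorm_congr_ae h0, eLpNorm_zero]

/-! ### Balance, equality of the rates and exact pseudo steady states -/

namespace MFProblem

variable {P : MFProblem}

theorem IsSolutionAfter.memLp {T : ℝ} {p s : ℝ → Plane → ℝ} (h : P.IsSolutionAfter T p s)
    {t : ℝ} (ht : T < t) : MemLp (p t) 2 (volume.restrict P.K) := by
  obtain ⟨G, hG, -⟩ := (h t ht).2.2.exists_gradient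
  exact hG.memLp

theorem IsSolutionAfter.hasDerivAt_setIntegral_Km {T : ℝ} {p s : ℝ → Plane → ℝ}
    (h : P.IsSolutionAfter T p s) {t : ℝ} (ht : T < t) :
    HasDerivAt (fun τ => ∫ x in P.Km, p τ x) (∫ x in P.Km, s t x) t :=
  (h t ht).1.hasDerivAt_integral
    ((lt_mem_nhds ht).mono fun _ hτ => P.memLp_Km (h.memLp hτ))

theorem IsSolutionAfter.hasDerivAt_setIntegral_Kf {T : ℝ} {p s : ℝ → Plane → ℝ}
    (h : P.IsSolutionAfter T p s) {t : ℝ} (ht : T < t) :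
    HasDerivAt (fun τ => ∫ x in P.Kf, p τ x) (∫ x in P.Kf, s t x) t :=
  (h t ht).2.1.hasDerivAt_integral
    ((lt_mem_nhds ht).mono fun _ hτ => P.memLp_Kf (h.memLp hτ))

theorem IsSolutionAfter.tendsto_setIntegral_rate {T : ℝ} {p s : ℝ → Plane → ℝ}
    (h : P.IsSolutionAfter T p s) {am af : ℝ} (hs : P.TendsToPseudoSteady s am af) :
    Tendsto (fun t => ∫ x in P.Km, s t x) atTop (𝓝 (volume.real P.Km * am)) ∧
      Tendsto (fun t => ∫ x in P.Kf, s t x) atTop (𝓝 (volume.real P.Kf * af)) := by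
  have h1 := tendsto_integral_of_L2 ((eventually_gt_atTop T).mono fun t ht => (h t ht).1.1)
    (memLp_const am) hs.1
  have h2 := tendsto_integral_of_L2 ((eventually_gt_atTop T).mono fun t ht => (h t ht).2.1.1)
    (memLp_const af) hs.2
  exact ⟨by simpa using h1, by simpa using h2⟩

theorem IsSolutionAfter.balance {T : ℝ} {p s : ℝ → Plane → ℝ}
    (h : P.IsSolutionAfter T p s) {am af : ℝ} (hs : P.TendsToPseudoSteady s am af) :
    P.Balance am af := by
  obtain ⟨h1, h2⟩ := h.tendsto_setIntegral_rate hs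
  have h3 : Tendsto (fun t => (∫ x in P.Km, P.cm * P.Φm * s t x) + ∫ x in P.Kf, P.cf * P.Φf * s t x)
      atTop (𝓝 (P.cm * P.Φm * (volume.real P.Km * am) + P.cf * P.Φf * (volume.real P.Kf * af))) := by
    simp_rw [integral_const_mul]
    exact (h1.const_mul _).add (h2.const_mul _)
  have h4 := tendsto_nhds_unique h3 (tendsto_const_nhds.congr'
    ((eventually_gt_atTop T).mono fun t ht => ((h t ht).2.2.mass_balance (h t ht).2.1.1).symm))
  rw [setIntegral_const, smul_eq_mul] at h4
  unfold Balance
  linarith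

/-- The mean over `K_m` minus the mean over `K_f` is the same for the pressure and for its
fluctuation. It therefore converges, and its derivative, which tends to `am - af`, must have limit
zero. -/
theorem IsSolutionAfter.rates_eq {T : ℝ} {p s : ℝ → Plane → ℝ}
    (h : P.IsSolutionAfter T p s) {am af : ℝ} (hs : P.TendsToPseudoSteady s am af)
    {w : Plane → ℝ} (hw : MemLp w 2 (volume.restrict P.K))
    (hlim : Tendsto (fun t => eLpNorm (fun x => P.fluctuation (p t) x - w x) 2
      (volume.restrict P.K)) atTop (𝓝 0)) : am = af := by
  have hVm := P.volume_real_Km_pos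
  have hVf := P.volume_real_Kf_pos
  obtain ⟨h1, h2⟩ := h.tendsto_setIntegral_rate hs
  have hmem : ∀ᶠ t in atTop, MemLp (P.fluctuation (p t)) 2 (volume.restrict P.K) :=
    (eventually_gt_atTop T).mono fun t ht => (h.memLp ht).sub (memLp_const _)
  have hD : ∀ D ⊆ P.K, Tendsto (fun t => ∫ x in D, P.fluctuation (p t) x) atTop
      (𝓝 (∫ x in D, w x)) := by
    intro D hDK
    have hle : volume.restrict D ≤ volume.restrict P.K := Measure.restrict_mono hDK le_rfl
    have : IsFiniteMeasure (volume.restrict D) := isFiniteMeasure_of_le _ hle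
    refine tendsto_integral_of_L2 (hmem.mono fun t ht => ht.mono_measure hle)
      (hw.mono_measure hle) ?_
    exact tendsto_of_tendsto_of_tendsto_of_le_of_le tendsto_const_nhds hlim (fun _ => zero_le)
      fun t => eLpNorm_mono_measure _ hle
  have hderiv : ∀ t, T < t → HasDerivAt
      (fun τ => (∫ x in P.Km, p τ x) / volume.real P.Km - (∫ x in P.Kf, p τ x) / volume.real P.Kf)
      ((∫ x in P.Km, s t x) / volume.real P.Km - (∫ x in P.Kf, s t x) / volume.real P.Kf) t :=
    fun t ht => ((h.hasDerivAt_setIntegral_Km ht).div_const _).fun_sub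
      ((h.hasDerivAt_setIntegral_Kf ht).div_const _)
  have hfl := ((hD P.Km P.Km_subset).div_const (volume.real P.Km)).sub
    ((hD P.Kf P.Kf_subset).div_const (volume.real P.Kf))
  have hf := hfl.congr' (f₂ := fun τ => (∫ x in P.Km, p τ x) / volume.real P.Km
      - (∫ x in P.Kf, p τ x) / volume.real P.Kf) ((eventually_gt_atTop T).mono fun t ht => by
    have hi := (h.memLp ht).integrable_two
    simp only [P.setIntegral_fluctuation P.Km_subset hi, P.setIntegral_fluctuation P.Kf_subset hi]
    field_simp
    ring)
  have h0 := eq_zero_of_tendsto_of_tendsto_deriv hderiv hf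
    ((h1.div_const (volume.real P.Km)).sub (h2.div_const (volume.real P.Kf)))
  rw [mul_div_cancel_left₀ _ hVm.ne', mul_div_cancel_left₀ _ hVf.ne'] at h0
  exact sub_eq_zero.1 h0

theorem Balance.fluxDivergence_ae_eq {am af : ℝ} (h : P.Balance am af) {s : Plane → ℝ}
    (hm : ∀ᵐ x ∂volume.restrict P.Km, s x = am) (hf : ∀ᵐ x ∂volume.restrict P.Kf, s x = af) :
    P.fluxDivergence s =ᵐ[volume.restrict P.K] P.stationarySource (P.q - P.cf * P.Φf * af) := by
  refine P.ae_K_iff.2 ⟨?_, ?_⟩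
  · filter_upwards [hm, ae_restrict_mem P.isOpen_Km.measurableSet] with x hx hxm
    rw [P.fluxDivergence_of_mem_Km s hxm, P.stationarySource_of_mem_Km _ hxm, h.matrix_source, hx]
  · filter_upwards [hf, ae_restrict_mem P.isOpen_Kf.measurableSet] with x hx hxm
    rw [P.fluxDivergence_of_mem_Kf s hxm, P.stationarySource_of_mem_Kf _ hxm, hx]

theorem Balance.tendsto_fluxDivergence {am af : ℝ} (h : P.Balance am af) {s : ℝ → Plane → ℝ}
    (hs : P.TendsToPseudoSteady s am af) :
    Tendsto (fun t => eLpNorm (fun x => P.fluxDivergence (s t) x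
      - P.stationarySource (P.q - P.cf * P.Φf * af) x) 2 (volume.restrict P.K)) atTop (𝓝 0) := by
  have hlim : Tendsto (fun t =>
      ‖-(P.cm * P.Φm)‖ₑ * eLpNorm (fun x => s t x - am) 2 (volume.restrict P.Km)
        + ‖-(P.cf * P.Φf)‖ₑ * eLpNorm (fun x => s t x - af) 2 (volume.restrict P.Kf))
      atTop (𝓝 0) := by
    simpa using (ENNReal.Tendsto.const_mul (a := ‖-(P.cm * P.Φm)‖ₑ) hs.1 (Or.inr enorm_ne_top)).add
      (ENNReal.Tendsto.const_mul (a := ‖-(P.cf * P.Φf)‖ₑ) hs.2 (Or.inr enorm_ne_top))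
  refine tendsto_of_tendsto_of_tendsto_of_le_of_le tendsto_const_nhds hlim (fun _ => zero_le)
    fun t => (P.eLpNorm_K_le _).trans (add_le_add (le_of_eq ?_) (le_of_eq ?_))
  · rw [← eLpNorm_const_smul]
    refine eLpNorm_congr_ae ?_
    filter_upwards [ae_restrict_mem P.isOpen_Km.measurableSet] with x hxm
    rw [P.fluxDivergence_of_mem_Km _ hxm, P.stationarySource_of_mem_Km _ hxm, h.matrix_source]
    simp only [Pi.smul_apply, smul_eq_mul]
    ring
  · rw [← eLpNorm_const_smul]
    refine eLpNorm_congr_ae ?_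
    filter_upwards [ae_restrict_mem P.isOpen_Kf.measurableSet] with x hxm
    rw [P.fluxDivergence_of_mem_Kf _ hxm, P.stationarySource_of_mem_Kf _ hxm]
    simp only [Pi.smul_apply, smul_eq_mul]
    ring

theorem IsPseudoSteadyAfter.stationary {T : ℝ} {p : ℝ → Plane → ℝ} {am af : ℝ}
    (h : P.IsPseudoSteadyAfter T p am af) :
    P.Balance am af ∧ am = af ∧
      (∀ t, T < t → P.IsStationarySolution (P.q - P.cf * P.Φf * af) (P.fluctuation (p t))) ∧
      ∃ C : ℝ, ∀ t, T < t → ⨍ x in P.K, p t x = af * t + C := by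
  obtain ⟨s, hsol, hs⟩ := h
  -- Constant rates converge trivially, so the results for convergent rates apply.
  have hps : P.TendsToPseudoSteady s am af := by
    constructor <;> refine tendsto_const_nhds.congr' ((eventually_gt_atTop T).mono fun t ht => ?_)
    · exact (eLpNorm_sub_eq_zero_of_ae_eq (g := fun _ => am) (hs t ht).1 2).symm
    · exact (eLpNorm_sub_eq_zero_of_ae_eq (g := fun _ => af) (hs t ht).2 2).symm
  have hbal := hsol.balance hps
  have hstat : ∀ t, T < t →
      P.IsStationarySolution (P.q - P.cf * P.Φf * af) (P.fluctuation (p t)) := by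
    intro t ht
    obtain ⟨G, hG, -, h0⟩ := (hsol t ht).2.2.exists_gradient
    refine isStationarySolution_fluctuation hG fun φ hφ => ?_
    rw [← normalTrace_congr_ae (hbal.fluxDivergence_ae_eq (hs t ht).1 (hs t ht).2)]
    exact h0 φ hφ
  have heq : am = af := by
    -- By uniqueness the fluctuation is the same at all times, so any one time, here `T + 1`,
    -- supplies the limit.
    refine hsol.rates_eq hps (w := P.fluctuation (p (T + 1)))
      ((hsol.memLp (lt_add_one T)).sub (memLp_const _)) ?_
    refine tendsto_const_nhds.congr' ((eventually_gt_atTop T).mono fun t ht => ?_)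
    exact (eLpNorm_sub_eq_zero_of_ae_eq
      (P.stationary_unique (hstat t ht) (hstat _ (lt_add_one T))) 2).symm
  refine ⟨hbal, heq, hstat, ?_⟩
  have hV := P.volume_real_K_pos
  have hder : ∀ t ∈ Ioi T, HasDerivAt (fun τ => (volume.real P.K)⁻¹ *
      ((∫ x in P.Km, p τ x) + ∫ x in P.Kf, p τ x) - af * τ) 0 t := by
    intro t ht
    have h1 := (((hsol.hasDerivAt_setIntegral_Km ht).add (hsol.hasDerivAt_setIntegral_Kf ht)
      ).const_mul (volume.real P.K)⁻¹).fun_sub ((hasDerivAt_id t).const_mul af)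
    rw [integral_congr_ae (hs t ht).1, integral_congr_ae (hs t ht).2, setIntegral_const,
      setIntegral_const, heq] at h1
    refine h1.congr_deriv ?_
    rw [smul_eq_mul, smul_eq_mul, ← add_mul, ← volume_real_K, inv_mul_cancel_left₀ hV.ne',
      mul_one, sub_self]
  obtain ⟨C, hC⟩ := isOpen_Ioi.exists_is_const_of_deriv_eq_zero isPreconnected_Ioi
    (fun t ht => (hder t ht).differentiableAt.differentiableWithinAt)
    (fun t ht => (hder t ht).deriv)
  refine ⟨C, fun t ht => ?_⟩
  have hi := hsol.memLp ht
  have h2 := hC t ht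
  rw [setAverage_eq, P.setIntegral_K (P.memLp_Km hi).integrable_two (P.memLp_Kf hi).integrable_two,
    smul_eq_mul]
  linarith

/-- Away from the interface, the two parts of the cell are separated. -/
theorem normalTrace_Km_Kf_eq_zero {w : Plane → Plane} {g : Plane → ℝ}
    (hw : MemLp w 2 (volume.restrict P.K)) (hg : MemLp g 2 (volume.restrict P.K))
    (h : ∀ φ : Plane → ℝ, ContDiff ℝ ∞ φ → normalTrace P.K w g φ = 0) {φ : Plane → ℝ}
    (hφ : ContDiff ℝ ∞ φ) (hd : Disjoint (tsupport φ) (closure P.interface)) :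
    normalTrace P.Km w g φ = 0 ∧ normalTrace P.Kf w g φ = 0 := by
  -- Near a common point of the two closures that is off the closed interface, a ball meets the
  -- convex set `K` in a connected set, which would be covered by the disjoint open sets `K_m` and
  -- `K_f` and meet both.
  have hdisj : Disjoint (tsupport φ ∩ closure P.Kf) (tsupport φ ∩ closure P.Km) := by
    refine disjoint_left.2 fun x hxf hxm => ?_
    obtain ⟨r, hr, hball⟩ := Metric.isOpen_iff.1 isClosed_closure.isOpen_compl x
      (disjoint_left.1 hd hxf.1)
    have hconn : IsPreconnected (Metric.ball x r ∩ P.K) :=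
      ((convex_ball x r).inter P.convex_K).isPreconnected
    obtain ⟨y, hy, hyK⟩ := Metric.mem_closure_iff.1 hxm.2 r hr
    obtain ⟨z, hz, hzK⟩ := Metric.mem_closure_iff.1 hxf.2 r hr
    rw [dist_comm] at hyK hzK
    obtain ⟨v, -, hv⟩ := hconn P.Km P.Kf P.isOpen_Km P.isOpen_Kf
      (fun v hv => by
        rcases P.mem_Km_or_Kf_or_interface hv.2 with h1 | h1 | h1
        · exact Or.inl h1
        · exact Or.inr h1
        · exact absurd (subset_closure h1) (hball hv.1))
      ⟨y, ⟨hyK, P.Km_subset hy⟩, hy⟩ ⟨z, ⟨hzK, P.Kf_subset hz⟩, hz⟩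
    exact disjoint_left.1 P.disjoint_Km_Kf hv.1 hv.2
  -- On the support of `φ`, `χ` is `1` on the matrix and `0` on the fracture, so the global
  -- condition for `χ φ` isolates the matrix part.
  obtain ⟨χ, hχ0, hχ1, -⟩ := exists_contMDiffMap_zero_one_of_isClosed (n := (⊤ : ℕ∞))
    (modelWithCornersSelf ℝ Plane) ((isClosed_tsupport φ).inter isClosed_closure)
    ((isClosed_tsupport φ).inter isClosed_closure) hdisj
  have hχ : ContDiff ℝ ∞ χ := χ.contMDiff.contDiff
  have hsm : ContDiff ℝ ∞ fun x => χ x * φ x := hχ.mul hφ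
  have e1 : normalTrace P.Km w g (fun x => χ x * φ x) = normalTrace P.Km w g φ := by
    refine normalTrace_congr P.isOpen_Km fun x hx => ?_
    by_cases hxs : x ∈ tsupport φ
    · simp [hχ1 ⟨hxs, subset_closure hx⟩]
    · simp [image_eq_zero_of_notMem_tsupport hxs]
  have e2 : normalTrace P.Kf w g (fun x => χ x * φ x) = 0 := by
    rw [normalTrace_congr P.isOpen_Kf (ψ := fun _ => 0) fun x hx => ?_]
    · simp [normalTrace]
    · by_cases hxs : x ∈ tsupport φ
      · simp [hχ0 ⟨hxs, subset_closure hx⟩]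
      · simp [image_eq_zero_of_notMem_tsupport hxs]
  have h1 := h _ hsm
  have h2 := h φ hφ
  rw [P.normalTrace_K hw hg hsm, e1, e2, add_zero] at h1
  rw [P.normalTrace_K hw hg hφ, h1, zero_add] at h2
  exact ⟨h1, h2⟩

/-- Uniqueness makes the fluctuation independent of time, so increments of the pressure are almost
everywhere those of its mean and the difference quotients equal `a` exactly. -/
theorem isPseudoSteadyAfter_of_stationary {T : ℝ} {p : ℝ → Plane → ℝ} {a C : ℝ}
    (hbal : P.Balance a a)
    (hstat : ∀ t, T < t →
      P.IsStationarySolution (P.q - P.cf * P.Φf * a) (P.fluctuation (p t)))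
    (hC : ∀ t, T < t → ⨍ x in P.K, p t x = a * t + C) : P.IsPseudoSteadyAfter T p a a := by
  have hderiv : ∀ t, T < t → ∀ D, D ⊆ P.K → HasL2TimeDeriv D p (fun _ => a) t := by
    intro t ht D hD
    refine ⟨continuous_const.memLp_restrict (P.isBounded_K.subset hD) 2, ?_⟩
    refine tendsto_const_nhds.congr' ?_
    have hev : ∀ᶠ h in 𝓝[≠] (0 : ℝ), T < t + h := by
      refine nhdsWithin_le_nhds ((lt_mem_nhds (by linarith : T - t < 0)).mono fun h hh => ?_)
      linarith
    filter_upwards [hev, self_mem_nhdsWithin] with h hh (hne : h ≠ 0)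
    have hae : P.fluctuation (p (t + h)) =ᵐ[volume.restrict D] P.fluctuation (p t) :=
      ae_mono (Measure.restrict_mono hD le_rfl) (P.stationary_unique (hstat _ hh) (hstat t ht))
    refine (eLpNorm_sub_eq_zero_of_ae_eq (g := fun _ => a) (hae.mono fun x hx => ?_) 2).symm
    simp only [fluctuation, hC _ hh, hC t ht] at hx
    have : p (t + h) x - p t x = a * h := by linarith
    rw [this]
    field_simp
  refine ⟨fun _ _ => a, fun t ht => ⟨hderiv t ht _ P.Km_subset, hderiv t ht _ P.Kf_subset, ?_⟩,
    fun t _ => ⟨.of_forall fun _ => rfl, .of_forall fun _ => rfl⟩⟩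
  obtain ⟨⟨G, hG, hdiv, htr⟩, -⟩ := hstat t ht
  -- The pressure is its fluctuation plus a constant, added by subtracting the negative of the mean.
  have hp : HasH1Gradient P.K (p t) G :=
    (hG.sub P.isBounded_K (HasH1Gradient.const P.isBounded_K (-⨍ x in P.K, p t x))).congr_ae
      (.of_forall fun x => by simp [fluctuation]) (.of_forall fun _ => sub_zero _)
  refine ⟨G, P.stationarySource (P.q - P.cf * P.Φf * a), hp.mono P.Km_subset, hp.mono P.Kf_subset,
    hdiv.mono P.Km_subset, ?_, hdiv.mono P.Kf_subset, ?_, fun φ hφ hd =>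
      normalTrace_Km_Kf_eq_zero hdiv.memLp hdiv.memLp_div htr hφ hd, fun φ hφ => ?_,
    fun φ hφ => ?_⟩
  · filter_upwards [ae_restrict_mem P.isOpen_Km.measurableSet] with x hx
    rw [P.stationarySource_of_mem_Km _ hx, hbal.matrix_source, add_neg_cancel]
  · filter_upwards [ae_restrict_mem P.isOpen_Kf.measurableSet] with x hx
    rw [P.stationarySource_of_mem_Kf _ hx]
    ring
  · have i1 : IntegrableOn (fun x => p t x • ∇ φ x) P.K :=
      integrable_bilin (ContinuousLinearMap.lsmul ℝ ℝ) hp.memLp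
        (hφ.1.continuous_gradient.memLp_restrict P.isBounded_K 2)
    have i2 : IntegrableOn (fun x => φ x • G x) P.K :=
      integrable_bilin (ContinuousLinearMap.lsmul ℝ ℝ)
        (hφ.1.continuous.memLp_restrict P.isBounded_K 2) hp.memLp_gradient
    have i3 : IntegrableOn (fun x => p t x • ∇ φ x + φ x • G x) P.K := i1.add i2
    rw [pressureTrace, pressureTrace, ← P.setIntegral_K (i3.mono_set P.Km_subset)
      (i3.mono_set P.Kf_subset), integral_add i1 i2, hp.weak_gradient φ hφ, neg_add_cancel]
  · rw [← P.normalTrace_K hdiv.memLp hdiv.memLp_div hφ.1, htr φ hφ.1]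

/-! ### The limit of large times -/

/-- Stability bounds the `H¹` distance of the fluctuations at two times by the distances of their
sources to the limiting source `σ`. Completeness gives a limit, and the weak gradient, zero mean and
vanishing normal trace are closed under `L²` convergence. -/
theorem IsSolutionAfter.exists_limit {p s : ℝ → Plane → ℝ} {T am af : ℝ}
    (h : P.IsSolutionAfter T p s) (hs : P.TendsToPseudoSteady s am af) :
    ∃ (w : Plane → ℝ) (Gw : Plane → Plane) (G : ℝ → Plane → Plane),
      P.IsStationarySolution (P.q - P.cf * P.Φf * af) w ∧
      HasH1Gradient P.K w Gw ∧ (∀ t, T < t → HasH1Gradient P.K (p t) (G t)) ∧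
      Tendsto (fun t => eLpNorm (fun x => P.fluctuation (p t) x - w x) 2
        (volume.restrict P.K)) atTop (𝓝 0) ∧
      Tendsto (fun t => eLpNorm (fun x => G t x - Gw x) 2
        (volume.restrict P.K)) atTop (𝓝 0) := by
  have hbal := h.balance hs
  set σ := P.stationarySource (P.q - P.cf * P.Φf * af) with hσ
  have hσm : MemLp σ 2 (volume.restrict P.K) := P.memLp_stationarySource _
  have hlim := hbal.tendsto_fluxDivergence hs
  choose! G hG hdm h0 using fun t (ht : T < t) => (h t ht).2.2.exists_gradient
  obtain ⟨C, hC⟩ := P.exists_stability_sub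
  set b : ℝ → ℝ≥0∞ := fun t => C * eLpNorm (fun x => P.fluxDivergence (s t) x - σ x) 2
    (volume.restrict P.K) with hb
  have hblim : Tendsto b atTop (𝓝 0) := by
    simpa using ENNReal.Tendsto.const_mul (a := (C : ℝ≥0∞)) hlim (by simp)
  have hdist : ∀ t, T < t → ∀ t', T < t' → C * eLpNorm (fun x => P.fluxDivergence (s t) x
      - P.fluxDivergence (s t') x) 2 (volume.restrict P.K) ≤ b t + b t' := by
    intro t ht t' ht'
    rw [hb, ← mul_add]
    gcongr
    have : (fun x => P.fluxDivergence (s t) x - P.fluxDivergence (s t') x)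
        = (fun x => P.fluxDivergence (s t) x - σ x) - fun x => P.fluxDivergence (s t') x - σ x := by
      ext x; simp
    rw [this]
    exact eLpNorm_sub_le ((hdm t ht).sub hσm).1 ((hdm t' ht').sub hσm).1 one_le_two
  obtain ⟨Gw, hGw, hGlim⟩ := exists_tendsto_of_eLpNorm_sub_le
    (fun t ht => (hG t ht).memLp_gradient)
    (fun t ht t' ht' => ((hC _ _ _ _ _ _ (hG t ht) (hG t' ht') (hdm t ht) (hdm t' ht')
      (h0 t ht) (h0 t' ht')).1).trans (hdist t ht t' ht')) hblim
  have hfm : ∀ t, T < t → HasH1Gradient P.K (P.fluctuation (p t)) (G t) := fun t ht =>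
    P.hasH1Gradient_fluctuation (hG t ht)
  obtain ⟨w, hw, hwlim⟩ := exists_tendsto_of_eLpNorm_sub_le
    (fun t ht => (hfm t ht).memLp)
    (fun t ht t' ht' => ((hC _ _ _ _ _ _ (hG t ht) (hG t' ht') (hdm t ht) (hdm t' ht')
      (h0 t ht) (h0 t' ht')).2).trans (hdist t ht t' ht')) hblim
  have hev := eventually_gt_atTop T
  have hH : HasH1Gradient P.K w Gw :=
    .of_tendsto P.isBounded_K (hev.mono hfm) hw hGw hwlim hGlim
  have hmean : ⨍ x in P.K, w x = 0 := by
    have h1 := tendsto_integral_of_L2 (hev.mono fun t ht => (hfm t ht).memLp) hw hwlim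
    have h2 := tendsto_nhds_unique h1 (tendsto_const_nhds.congr' (hev.mono fun t ht =>
      (P.integral_fluctuation (hG t ht).memLp.integrable_two).symm))
    rw [setAverage_eq, h2, smul_zero]
  have htr : ∀ φ : Plane → ℝ, ContDiff ℝ ∞ φ → normalTrace P.K (P.darcyFlux Gw) σ φ = 0 := by
    intro φ hφ
    obtain ⟨Cf, hCf⟩ := P.exists_eLpNorm_darcyFlux_le
    have hflux : Tendsto (fun t => eLpNorm (fun x => P.darcyFlux (G t) x - P.darcyFlux Gw x) 2
        (volume.restrict P.K)) atTop (𝓝 0) := by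
      have h1 : Tendsto (fun t => Cf * eLpNorm (fun x => G t x - Gw x) 2 (volume.restrict P.K))
          atTop (𝓝 0) := by
        simpa using ENNReal.Tendsto.const_mul (a := (Cf : ℝ≥0∞)) hGlim (by simp)
      refine tendsto_of_tendsto_of_tendsto_of_le_of_le tendsto_const_nhds h1 (fun _ => zero_le)
        fun t => ?_
      rw [← P.darcyFlux_sub]
      exact hCf _
    have h1 := normalTrace_tendsto P.isBounded_K
      (hev.mono fun t ht => P.memLp_darcyFlux (hG t ht).memLp_gradient) (hev.mono hdm)
      (P.memLp_darcyFlux hGw) hσm hflux hlim hφ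
    exact tendsto_nhds_unique h1 (tendsto_const_nhds.congr' (hev.mono fun t ht => (h0 t ht φ hφ).symm))
  have hstat := isStationarySolution_fluctuation hH htr
  rw [P.fluctuation_of_average_eq_zero hmean] at hstat
  exact ⟨w, Gw, G, hstat, hH, hG, hwlim, hGlim⟩

end MFProblem
theorem mainTheorem1 (P : MFProblem) :
    -- mass balance of every solution, at every time
    (∀ (T : ℝ) (p s : ℝ → Plane → ℝ), P.IsSolutionAfter T p s → ∀ t, T < t →
      (∫ x in P.Km, P.cm * P.Φm * s t x) + (∫ x in P.Kf, P.cf * P.Φf * s t x)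
        = ∫ _x in P.Kf, P.q) ∧
    -- the stationary problem with zero mean has at most one solution
    (∀ (qs : ℝ) (u v : Plane → ℝ), P.IsStationarySolution qs u → P.IsStationarySolution qs v →
      u =ᵐ[volume.restrict P.K] v) ∧
    -- exact pseudo steady state: the balance, and equivalence with the stationary problem
    (∀ (T : ℝ) (p : ℝ → Plane → ℝ) (am af : ℝ),
      P.IsPseudoSteadyAfter T p am af ↔
        P.Balance am af ∧ am = af ∧
        (∀ t, T < t →
          P.IsStationarySolution (P.q - P.cf * P.Φf * af) (P.fluctuation (p t))) ∧
        ∃ C : ℝ, ∀ t, T < t → ⨍ x in P.K, p t x = af * t + C) ∧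
    -- zero initial data: pseudo steady state as the limit of large times
    (∀ (p s : ℝ → Plane → ℝ) (am af : ℝ),
      P.IsInitialValueSolution p s → P.TendsToPseudoSteady s am af →
        P.Balance am af ∧ am = af ∧
        ∃ (w : Plane → ℝ) (Gw : Plane → Plane) (G : ℝ → Plane → Plane),
          P.IsStationarySolution (P.q - P.cf * P.Φf * af) w ∧
          HasH1Gradient P.K w Gw ∧ (∀ t, 0 < t → HasH1Gradient P.K (p t) (G t)) ∧
          Tendsto (fun t => eLpNorm (fun x => P.fluctuation (p t) x - w x) 2
            (volume.restrict P.K)) atTop (𝓝 0) ∧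
          Tendsto (fun t => eLpNorm (fun x => G t x - Gw x) 2
            (volume.restrict P.K)) atTop (𝓝 0)) := by
  refine ⟨fun T p s h t ht => (h t ht).2.2.mass_balance (h t ht).2.1.1,
    fun qs u v hu hv => P.stationary_unique hu hv,
    fun T p am af => ⟨fun h => h.stationary, ?_⟩, fun p s am af h hs => ?_⟩
  · rintro ⟨hbal, rfl, hstat, C, hC⟩
    exact MFProblem.isPseudoSteadyAfter_of_stationary hbal hstat hC
  · obtain ⟨w, Gw, G, hw, hGw, hG, hwlim, hGlim⟩ := h.1.exists_limit hs
    exact ⟨h.1.balance hs, h.1.rates_eq hs hGw.memLp hwlim, w, Gw, G, hw, hGw, hG, hwlim, hGlim⟩
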